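/- For $n\ge 1$ let $W(\tilde A_n)$ be the affine Coxeter group with generators $\sigma_1,\dots,\sigma_n,a_{n+1}$ whose Dynkin diagram is the cycle $\sigma_1 - \sigma_2 - \cdots - \sigma_n - a_{n+1} - \sigma_1$ (for $n=1$: two generators with $m_{\sigma_1a_2}=\infty$), and let $l$ be its length function. An element is fully commutative if any reduced expression of it can be transformed into any other one by commutation relations only; $W^c(\tilde A_n)$ is the set of fully commutative elements, and for $w\in W^c(\tilde A_n)$ the affine length $L(w)$ is the number of occurrences of $a_{n+1}$ in a (any) reduced expression of $w$. Let $W^c(A_m)$ be the set of fully commutative elements of the Coxeter group $W(A_m)$ with generators $\sigma_1,\dots,\sigma_m$, which for $m\le n$ is identified with the parabolic subgroup of $W(\tilde A_n)$ generated by $\sigma_1,\dots,\sigma_m$. Put $\lfloor i,j\rfloor=\sigma_i\sigma_{i-1}\cdots\sigma_j$ (empty if $i=j-1$), $\lceil i,j\rceil=\sigma_i\sigma_{i+1}\cdots\sigma_j$ (empty if $i=j+1$) and $h(i,r)=\lfloor i,1\rfloor\lceil r,n\rceil$. A normal form of $w\in W^c(\tilde A_n)$ is a reduced expression of $w$ of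 the form $$h(i_1,r_1)\,a_{n+1}\cdots h(i_p,r_p)\,a_{n+1}\,\bigl(h(j,j+1)\,a_{n+1}\bigr)^k\,w_r,\qquad p,k\ge 0,$$ where * $w_r=\lfloor l_1,g_1\rfloor\cdots\lfloor l_t,g_t\rfloor$ for some $t\ge 0$, with $1\le l_1<\dots<l_t\le n$, $1\le g_1<\dots<g_t\le n$ and $l_i\ge g_i$ for all $i$; * if $p>0$: $0\le i_1<\dots<i_p<r_p<\dots<r_1\le n+1$ and $r_p-i_p\ge 2$; * if $k>0$: $1\le j\le n$; $l_i=j+i-1$ for $1\le i\le t$; and, if also $p>0$, either $i_p<j<j+1<r_p$ or $j+1=r_p$; * if $k=0$, $p>0$ and $t\ge 1$: $i_p<l_1<r_p$, and $l_i<r_p$ for every $i\ge 2$ with $l_i>l_{i-1}+1$. **Theorem.** Let $n\ge 2$. Every $w\in W^c(\tilde A_{n-1})$ has exactly one normal form (as a word). Let $I(w)$ (resp. $J(w)$) be the element of $W(\tilde A_n)$ obtained by substituting $\sigma_n a_{n+1}$ (resp. $a_{n+1}\sigma_n$) for every occurrence of $a_n$ in the normal form of $w$. Then both resulting words are reduced,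 both $I(w)$ and $J(w)$ are fully commutative, with the same affine length as $w$: $L(I(w))=L(J(w))=L(w)$, and $l(I(w))=l(J(w))=l(w)+L(w)$. The maps $$I,J: W^c(\tilde A_{n-1})\longrightarrow W^c(\tilde A_n)$$ are injective. Both restrict to the identity on $W^c(A_{n-1})$, and the images of $I$ and $J$ intersect exactly in $W^c(A_{n-1})$. -/

import Mathlib

namespace AffineFC

/-! ### Fully commutative elements of a Coxeter system -/

/-- One commutation move: two neighbouring letters `s, t` with `m_{st} = 2` are exchanged. -/
def CommMove {B : Type*} (M : CoxeterMatrix B) (ω ω' : List B) : Prop :=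
  ∃ (u v : List B) (s t : B), M s t = 2 ∧ ω = u ++ s :: t :: v ∧ ω' = u ++ t :: s :: v

/-- `W^c`: the elements for which one can pass from any reduced expression to any other one
by applying commutation relations only. -/
def fullyCommutative {B W : Type*} [Group W] {M : CoxeterMatrix B} (cs : CoxeterSystem M W) :
    Set W :=
  {w | ∀ ω ω' : List B, cs.IsReduced ω → cs.wordProd ω = w →
    cs.IsReduced ω' → cs.wordProd ω' = w → Relation.ReflTransGen (CommMove M) ω ω'}

/-! ### The affine Coxeter group of type `Ã_n` -/

/-- The Coxeter matrix of type `Ã_n` (`n ≥ 1`), whose Dynkin diagram is a cycle on `n + 1` nodes: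
the node `0` is `a_{n+1}`, and the node `i` is `σ_i` for `1 ≤ i ≤ n`. Addition in `Fin (n + 1)` is
modulo `n + 1`. For `n = 1` the two generators are joined by an edge labelled `∞`, which Mathlib
encodes as `0`. -/
def affineA (n : ℕ) : CoxeterMatrix (Fin (n + 1)) where
  M := Matrix.of fun i j ↦
    if i = j then 1
    else if n = 1 then 0
    else if i + 1 = j ∨ j + 1 = i then 3
    else 2
  isSymm := by
    ext i j
    simp only [Matrix.transpose_apply, Matrix.of_apply, eq_comm (a := j) (b := i),
      or_comm (a := j + 1 = i)]
  diagonal := by simp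
  off_diagonal := by
    intro i j h
    simp only [Matrix.of_apply, if_neg h]
    split_ifs <;> simp

/-- The affine Coxeter group `W(Ã_n)`. -/
abbrev WAff (n : ℕ) : Type := (affineA n).Group

/-- `W(Ã_n)` with its Coxeter generators `σ_1, …, σ_n, a_{n+1}`. -/
abbrev csAff (n : ℕ) : CoxeterSystem (affineA n) (WAff n) := (affineA n).toCoxeterSystem

/-- `W^c(Ã_n)`. -/
abbrev WcAff (n : ℕ) : Set (WAff n) := fullyCommutative (csAff n)

/-- The affine length `L(w)`: the number of occurrences of `a_{n+1}` in a reduced expression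
of `w`. (For fully commutative `w` the choice does not matter: `affineLength_wordProd`.) -/
noncomputable def affineLength (n : ℕ) (w : WAff n) : ℕ :=
  ((csAff n).exists_isReduced w).choose.count 0

theorem affineLength_wordProd {n : ℕ} {w : WAff n} (hw : w ∈ WcAff n) {ω : List (Fin (n + 1))}
    (hω : (csAff n).IsReduced ω) (h : (csAff n).wordProd ω = w) :
    affineLength n w = ω.count 0 := by
  have hc := ((csAff n).exists_isReduced w).choose_spec
  have hr := hw _ ω hc.1 hc.2.symm hω h
  have hp : ∀ {x y : List (Fin (n + 1))},
      Relation.ReflTransGen (CommMove (affineA n)) x y → x.Perm y := by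
    intro x y hxy
    induction hxy with
    | refl => exact List.Perm.refl _
    | tail _ h2 ih =>
      obtain ⟨u, v, s, t, -, rfl, rfl⟩ := h2
      exact ih.trans ((List.Perm.swap t s v).append_left u)
  exact (hp hr).count_eq 0

/-! ### The group `W(A_n)` and its embedding in `W(Ã_m)` -/

/-- The Coxeter group `W(A_n)`; the node `i : Fin n` is `σ_{i+1}`. -/
abbrev WA (n : ℕ) : Type := (CoxeterMatrix.A n).Group

/-- `W^c(A_n)`. -/
abbrev WcA (n : ℕ) : Set (WA n) := fullyCommutative (CoxeterMatrix.A n).toCoxeterSystem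

/-- The homomorphism `W(A_n) → W(Ã_m)`, `σ_i ↦ σ_i` for `1 ≤ i ≤ n`, where `n ≤ m`; it identifies
`W(A_n)` with a parabolic subgroup of `W(Ã_m)`. -/
noncomputable def embA (n m : ℕ) (h : n ≤ m) : WA n →* WAff m :=
  (CoxeterMatrix.A n).toCoxeterSystem.lift
    ⟨fun i ↦ (csAff m).simple ⟨i + 1, by omega⟩, by
      intro i j
      have hM : (CoxeterMatrix.A n) i j =
          affineA m (⟨i + 1, by omega⟩ : Fin (m + 1)) ⟨j + 1, by omega⟩ := by
        have key : ∀ a b : Fin n, (((⟨a + 1, by omega⟩ : Fin (m + 1)) + 1 = ⟨b + 1, by omega⟩) ↔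
            (a : ℕ) + 1 = b) := by
          intro a b
          rw [Fin.ext_iff, Fin.val_add_eq_ite, Fin.val_one']
          have ha := a.2
          have hb := b.2
          rw [Nat.mod_eq_of_lt (by omega : 1 < m + 1)]
          simp only
          split_ifs <;> omega
        simp only [CoxeterMatrix.A, affineA, Matrix.of_apply, Fin.mk.injEq, add_left_inj, key,
          Fin.ext_iff (a := i)]
        split_ifs <;> omega
      rw [hM]
      exact (csAff m).simple_mul_simple_pow _ _⟩

/-! ### Normal forms

Words are first written with natural numbers as letters: `0` stands for `a_{n+1}`, and `i` for
`σ_i`, `1 ≤ i ≤ n`. -/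

/-- `⌊i, j⌋ = σ_i σ_{i-1} ⋯ σ_j` (empty for `i + 1 = j`). -/
def desc (i j : ℕ) : List ℕ := (List.Ico j (i + 1)).reverse

/-- `⌈i, j⌉ = σ_i σ_{i+1} ⋯ σ_j` (empty for `i = j + 1`). -/
def asc (i j : ℕ) : List ℕ := List.Ico i (j + 1)

/-- `h(i, r) = ⌊i, 1⌋ ⌈r, n⌉`. -/
def hWord (n i r : ℕ) : List ℕ := desc i 1 ++ asc r n

/-- The word `⌊l_1, g_1⌋ ⌊l_2, g_2⌋ ⋯ ⌊l_s, g_s⌋` for a list of pairs `(l_t, g_t)`. -/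
def blockWord (B : List (ℕ × ℕ)) : List ℕ := B.flatMap fun b ↦ desc b.1 b.2

/-- `1 ≤ l_1 < ⋯ < l_s ≤ n`, `1 ≤ g_1 < ⋯ < g_s ≤ n` and `l_t ≥ g_t` for all `t`. -/
def IsStembridge (n : ℕ) (B : List (ℕ × ℕ)) : Prop :=
  B.Pairwise (fun b b' ↦ b.1 < b'.1 ∧ b.2 < b'.2) ∧ ∀ b ∈ B, 1 ≤ b.2 ∧ b.2 ≤ b.1 ∧ b.1 ≤ n

/-- The word `h(i_1, r_1) a_{n+1} ⋯ h(i_p, r_p) a_{n+1} (h(j, j+1) a_{n+1})^k w_r`, where `H` is the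
list of the pairs `(i_t, r_t)` and `w_r` is given by the list `B` of pairs `(l_t, g_t)`. -/
def formWord (n : ℕ) (H : List (ℕ × ℕ)) (j k : ℕ) (B : List (ℕ × ℕ)) : List ℕ :=
  (H.flatMap fun q ↦ hWord n q.1 q.2 ++ [0]) ++
    (List.replicate k (hWord n j (j + 1) ++ [0])).flatten ++ blockWord B

/-- The conditions on the parameters of a normal form in `W^c(Ã_n)`. -/
structure IsNormalData (n : ℕ) (H : List (ℕ × ℕ)) (j k : ℕ) (B : List (ℕ × ℕ)) : Prop where
  /-- `w_r` is in the standard form of the elements of `W^c(A_n)`. For `p = k = 0` (affine length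
  zero) there is no other condition. -/
  right : IsStembridge n B
  /-- `0 ≤ i_1 < ⋯ < i_p < r_p < ⋯ < r_1 ≤ n + 1` and `r_p - i_p ≥ 2`. -/
  nested : H.Pairwise (fun q q' ↦ q.1 < q'.1 ∧ q'.2 < q.2)
  gap : ∀ q ∈ H, q.1 + 2 ≤ q.2 ∧ q.2 ≤ n + 1
  /-- If `k > 0`, then `1 ≤ j ≤ n`. -/
  j_mem : 0 < k → 1 ≤ j ∧ j ≤ n
  /-- If `k > 0` and `p > 0`, then `i_p < j < j + 1 < r_p` or `j + 1 = r_p`. -/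
  last_pos : 0 < k → ∀ q ∈ H.getLast?, (q.1 < j ∧ j + 1 < q.2) ∨ j + 1 = q.2
  /-- If `k > 0`, then `w_r = ⌊j, d_1⌋ ⌊j+1, d_2⌋ ⋯ ⌊j+z-1, d_z⌋`. -/
  right_pos : 0 < k → B.map Prod.fst = List.Ico j (j + B.length)
  /-- If `k = 0` and `p > 0`, then `i_p < l_1 < r_p` (when `w_r ≠ 1`). -/
  right_zero_head : k = 0 → ∀ q ∈ H.getLast?, ∀ b ∈ B.head?, q.1 < b.1 ∧ b.1 < q.2
  /-- If `k = 0` and `p > 0`, then `l_i < r_p` for any `i ≥ 2` with `l_i > l_{i-1} + 1`. -/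
  right_zero_chain : k = 0 → ∀ q ∈ H.getLast?,
    B.IsChain (fun b b' ↦ b.1 + 1 < b'.1 → b'.1 < q.2)

/-- `ω` is a normal form of `w ∈ W(Ã_n)`: a reduced expression of `w` of the form above. -/
def IsNormalForm (n : ℕ) (w : WAff n) (ω : List (Fin (n + 1))) : Prop :=
  (csAff n).IsReduced ω ∧ (csAff n).wordProd ω = w ∧
    ∃ (H : List (ℕ × ℕ)) (j k : ℕ) (B : List (ℕ × ℕ)), IsNormalData n H j k B ∧
      ω = (formWord n H j k B).map (Fin.ofNat (n + 1))

/-! ### The two substitutions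

A word in the generators of `W(Ã_n)` is turned into a word in the generators of `W(Ã_{n+1})`. -/

/-- Replace every `a_{n+1}` by `σ_{n+1} a_{n+2}`. -/
def substI (n : ℕ) (ω : List (Fin (n + 1))) : List (Fin (n + 2)) :=
  ω.flatMap fun i ↦ if i = 0 then [Fin.last (n + 1), 0] else [i.castSucc]

/-- Replace every `a_{n+1}` by `a_{n+2} σ_{n+1}`. -/
def substJ (n : ℕ) (ω : List (Fin (n + 1))) : List (Fin (n + 2)) :=
  ω.flatMap fun i ↦ if i = 0 then [0, Fin.last (n + 1)] else [i.castSucc]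

end AffineFC

namespace AffineFC

/-! ### Words on a cycle -/

/-! The rank called `n` here is `n - 1` in the statement in words.

A word is studied through its projections to pairs of adjacent letters of the Dynkin cycle. Two
words differ by commutations exactly when all these projections agree (`Eqv`). The reduced
expressions of fully commutative elements are exactly the words whose projections have no two equal
consecutive letters (`Alt`): a violation produces a square or a braid move
(`IsCycleDiagram.alt_of_fullyCommutative`), and conversely the exchange property shows by induction
that an alternating word is reduced and that its commutation class contains all reduced expressions
of the element (`Alt.isReduced_and_eqv`). So fully commutative elements are commutation classes of
alternating words.

Each class contains exactly one `LexMax` word, built from the right by always taking the greatest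
letter that can be moved to the end. As `0` is the smallest letter, it is taken only when nothing
else is available; this forces the piece before each `0` to be some h(i, r). Alternation then makes
successive pieces nest, until a piece contains all letters `1, …, n`; from there on the piece
repeats. Hence canonical words have the normal shape (`exists_isNormalData`). Conversely every word
of normal shape is `LexMax` (`IsNormalData.lexMax`), which gives uniqueness.

The substitutions subdivide the edge between `n` and `0` by a new node `n + 1`. The projections to
old pairs do not change, the one to `n, n + 1` is the old one to `n, 0` with `0` renamed, and the
one to `n + 1, 0` is a power of the substituted word. So `Alt` is preserved and `Eqv` is preserved
and reflected: the maps are well defined on elements and injective, and their values are fully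
commutative. In the last projection the values of `I` and `J` begin with different letters as soon
as `0` occurs, so a common value comes from a word without `0`. -/

/-- Adjacency in the cycle on `0, 1, …, n`. -/
def Adj (n x y : ℕ) : Prop :=
  x ≤ n ∧ y ≤ n ∧ (x + 1 = y ∨ y + 1 = x ∨ (x = 0 ∧ y = n) ∨ (x = n ∧ y = 0))

instance (n x y : ℕ) : Decidable (Adj n x y) := by unfold Adj; infer_instance

theorem Adj.symm {n x y : ℕ} (h : Adj n x y) : Adj n y x := by
  unfold Adj at *; omega

theorem Adj.ne {n x y : ℕ} (hn : 1 ≤ n) (h : Adj n x y) : x ≠ y := by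
  unfold Adj at *; omega

theorem exists_adj {n x : ℕ} (hn : 1 ≤ n) (hx : x ≤ n) : ∃ y, Adj n x y := by
  rcases Nat.lt_or_ge x n with h | h
  · exact ⟨x + 1, by unfold Adj; omega⟩
  · exact ⟨0, by unfold Adj; omega⟩

/-- The projection of a word to the letters `s` and `t`. -/
def proj (s t : ℕ) (ω : List ℕ) : List ℕ := ω.filter fun x ↦ x = s ∨ x = t

@[simp] theorem proj_append (s t : ℕ) (u v : List ℕ) :
    proj s t (u ++ v) = proj s t u ++ proj s t v := by simp [proj]

@[simp] theorem proj_nil (s t : ℕ) : proj s t [] = [] := rfl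

theorem proj_cons_of_mem {s t a : ℕ} (h : a = s ∨ a = t) (u : List ℕ) :
    proj s t (a :: u) = a :: proj s t u := by simp [proj, h]

theorem proj_cons_of_notMem {s t a : ℕ} (h : ¬(a = s ∨ a = t)) (u : List ℕ) :
    proj s t (a :: u) = proj s t u := by simp only [proj, List.filter_cons]; simp [h]

theorem proj_comm (s t : ℕ) (u : List ℕ) : proj s t u = proj t s u := by
  simp only [proj, or_comm]

theorem mem_proj {s t x : ℕ} {u : List ℕ} : x ∈ proj s t u ↔ x ∈ u ∧ (x = s ∨ x = t) := by
  simp [proj]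

/-- Two words have the same projections to all pairs of adjacent letters. -/
def Eqv (n : ℕ) (ω ω' : List ℕ) : Prop := ∀ s t, Adj n s t → proj s t ω = proj s t ω'

namespace Eqv

variable {n : ℕ} {u u' v v' w : List ℕ}

theorem refl (n : ℕ) (u : List ℕ) : Eqv n u u := fun _ _ _ ↦ rfl

theorem symm (h : Eqv n u v) : Eqv n v u := fun s t hst ↦ (h s t hst).symm

theorem trans (h : Eqv n u v) (h' : Eqv n v w) : Eqv n u w :=
  fun s t hst ↦ (h s t hst).trans (h' s t hst)

theorem append (h : Eqv n u u') (h' : Eqv n v v') : Eqv n (u ++ v) (u' ++ v') := by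
  intro s t hst
  rw [proj_append, proj_append, h s t hst, h' s t hst]

theorem cons (a : ℕ) (h : Eqv n u u') : Eqv n (a :: u) (a :: u') :=
  append (refl n [a]) h

theorem cancel_right (h : Eqv n (v ++ u) (v' ++ u)) : Eqv n v v' := by
  intro s t hst
  have := h s t hst
  simpa using this

theorem swap {a b : ℕ} (hab : a ≠ b) (h : ¬Adj n a b) : Eqv n [a, b] [b, a] := by
  intro s t hst
  by_cases ha : a = s ∨ a = t
  · by_cases hb : b = s ∨ b = t
    · exfalso
      rcases ha with rfl | rfl <;> rcases hb with rfl | rfl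
      · exact hab rfl
      · exact h hst
      · exact h hst.symm
      · exact hab rfl
    · rw [proj_cons_of_mem ha, proj_cons_of_notMem hb, proj_cons_of_notMem hb,
        proj_cons_of_mem ha]
  · by_cases hb : b = s ∨ b = t
    · rw [proj_cons_of_notMem ha, proj_cons_of_mem hb, proj_cons_of_mem hb,
        proj_cons_of_notMem ha]
    · rw [proj_cons_of_notMem ha, proj_cons_of_notMem hb, proj_cons_of_notMem hb,
        proj_cons_of_notMem ha]

theorem swap_cons {a b : ℕ} (hab : a ≠ b) (h : ¬Adj n a b) (u : List ℕ) :
    Eqv n (a :: b :: u) (b :: a :: u) :=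
  append (swap hab h) (refl n u)

theorem move {a : ℕ} {u : List ℕ} (h : ∀ c ∈ u, c ≠ a ∧ ¬Adj n a c) :
    Eqv n (a :: u) (u ++ [a]) := by
  induction u with
  | nil => exact refl n _
  | cons c u ih =>
    have hc := h c (by simp)
    exact (swap_cons hc.1.symm hc.2 u).trans (cons c (ih fun d hd ↦ h d (by simp [hd])))

theorem mem_of_mem (h : Eqv n u v) (hn : 1 ≤ n) {x : ℕ} (hx : x ≤ n) (hxu : x ∈ u) : x ∈ v := by
  obtain ⟨y, hy⟩ := exists_adj hn hx
  have : x ∈ proj x y u := mem_proj.2 ⟨hxu, Or.inl rfl⟩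
  rw [h x y hy] at this
  exact (mem_proj.1 this).1

theorem count_eq (h : Eqv n u v) (hn : 1 ≤ n) {x : ℕ} (hx : x ≤ n) : u.count x = v.count x := by
  obtain ⟨y, hy⟩ := exists_adj hn hx
  have key : ∀ w : List ℕ, (proj x y w).count x = w.count x := fun w ↦
    List.count_filter (by simp)
  rw [← key u, ← key v, h x y hy]

theorem perm (h : Eqv n u v) (hn : 1 ≤ n) (hu : ∀ x ∈ u, x ≤ n) (hv : ∀ x ∈ v, x ≤ n) :
    u.Perm v := by
  rw [List.perm_iff_count]
  intro x
  by_cases hx : x ≤ n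
  · exact h.count_eq hn hx
  · rw [List.count_eq_zero_of_not_mem fun h' ↦ hx (hu x h'),
      List.count_eq_zero_of_not_mem fun h' ↦ hx (hv x h')]

end Eqv

/-- Between two occurrences of a letter `x` all neighbours of `x` occur. -/
def Alt (n : ℕ) (ω : List ℕ) : Prop :=
  ∀ (P u Q : List ℕ) (x y : ℕ), ω = P ++ x :: u ++ x :: Q → Adj n x y → y ∈ u

/-- Two equal consecutive letters in a projection are two occurrences of a letter with a neighbour
missing in between. In this form the condition is visibly invariant under `Eqv`. -/
theorem alt_iff_isChain_proj {n : ℕ} {ω : List ℕ} :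
    Alt n ω ↔ ∀ s t, Adj n s t → (proj s t ω).IsChain (· ≠ ·) := by
  constructor
  · intro h s t hst
    rw [List.isChain_iff_forall_rel_of_append_cons_cons]
    rintro a _ l₁ l₂ hl rfl
    obtain ⟨P, R, rfl, -, hR⟩ := List.filter_eq_append_iff.1 hl
    obtain ⟨P', R', rfl, -, ha, hR'⟩ := List.filter_eq_cons_iff.1 hR
    obtain ⟨u, Q, rfl, hu, -, -⟩ := List.filter_eq_cons_iff.1 hR'
    simp only [decide_eq_true_eq] at ha hu
    rcases ha with rfl | rfl
    · exact hu t (h (P ++ P') u Q _ _ (by simp) hst) (Or.inr rfl)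
    · exact hu s (h (P ++ P') u Q _ _ (by simp) hst.symm) (Or.inl rfl)
  · rintro h P u Q x y rfl hxy
    by_contra hy
    have h1 := h x y hxy
    have hu : ∀ z ∈ proj x y u, z = x := by
      intro z hz
      obtain ⟨hz, rfl | rfl⟩ := mem_proj.1 hz
      · rfl
      · exact absurd ‹_› hy
    rw [proj_append, proj_append, proj_cons_of_mem (Or.inl rfl), proj_cons_of_mem (Or.inl rfl),
      List.isChain_iff_forall_rel_of_append_cons_cons] at h1
    rcases hp : proj x y u with _ | ⟨z, r⟩
    · exact h1 (a := _) (l₁ := proj x y P) (b := x) (l₂ := proj x y Q) (by rw [hp]; simp) rfl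
    · have hz : z = x := hu z (by simp [hp])
      subst hz
      exact h1 (a := _) (l₁ := proj z y P) (b := z) (l₂ := r ++ z :: proj z y Q)
        (by rw [hp]; simp) rfl

theorem Alt.eqv {n : ℕ} {u v : List ℕ} (hu : Alt n u) (h : Eqv n u v) : Alt n v := by
  rw [alt_iff_isChain_proj] at *
  intro s t hst
  rw [← h s t hst]
  exact hu s t hst

theorem Alt.infix {n : ℕ} {u ω : List ℕ} (h : Alt n ω) (hu : u <:+: ω) : Alt n u := by
  obtain ⟨A, B, rfl⟩ := hu
  rintro P v Q x y rfl hxy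
  exact h (A ++ P) v (Q ++ B) x y (by simp) hxy

theorem Alt.of_cons {n a : ℕ} {u : List ℕ} (h : Alt n (a :: u)) : Alt n u :=
  h.infix (List.suffix_cons a u).isInfix

/-! ### Letters that can be moved to the end -/

/-- The letter `a` occurs in `ω` and can be commuted to the end. -/
def Av (n a : ℕ) (ω : List ℕ) : Prop :=
  ∃ P Q : List ℕ, ω = P ++ a :: Q ∧ ∀ c ∈ Q, c ≠ a ∧ ¬Adj n a c

theorem av_concat {n a b : ℕ} {u : List ℕ} :
    Av n a (u ++ [b]) ↔ a = b ∨ (Av n a u ∧ b ≠ a ∧ ¬Adj n a b) := by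
  constructor
  · rintro ⟨P, Q, h, hQ⟩
    rcases List.eq_nil_or_concat Q with rfl | ⟨Q', c, rfl⟩
    · left
      have := List.append_inj' h rfl
      simpa using this.2.symm
    · right
      have h' : u ++ [b] = (P ++ a :: Q') ++ [c] := by rw [h]; simp
      obtain ⟨rfl, h2⟩ := List.append_inj' h' rfl
      obtain rfl : b = c := by simpa using h2
      refine ⟨⟨P, Q', rfl, fun d hd ↦ hQ d (by simp [hd])⟩, hQ b (by simp)⟩
  · rintro (rfl | ⟨⟨P, Q, rfl, hQ⟩, hb⟩)
    · exact ⟨u, [], by simp, by simp⟩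
    · refine ⟨P, Q ++ [b], by simp, ?_⟩
      intro c hc
      rcases List.mem_append.1 hc with hc | hc
      · exact hQ c hc
      · rw [List.mem_singleton.1 hc]
        exact hb

theorem not_av_nil {n a : ℕ} : ¬Av n a [] := by
  rintro ⟨P, Q, h, -⟩
  simp at h

theorem Av.mem {n a : ℕ} {u : List ℕ} (h : Av n a u) : a ∈ u := by
  obtain ⟨P, Q, rfl, -⟩ := h
  simp

theorem Av.exists_eqv {n a : ℕ} {u : List ℕ} (h : Av n a u) :
    ∃ P Q, u = P ++ a :: Q ∧ Eqv n u (P ++ Q ++ [a]) := by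
  obtain ⟨P, Q, rfl, hQ⟩ := h
  exact ⟨P, Q, rfl, by simpa using (Eqv.refl n P).append (Eqv.move hQ)⟩

/-- Take the last `a` in `u`. If a neighbour `c` of `a` occurred after it, the projection to `a, c`
would end in `c`, whereas that of `v ++ [a]` ends in `a`. -/
theorem Eqv.av_of_concat {n a : ℕ} {u v : List ℕ} (hn : 1 ≤ n) (ha : a ≤ n)
    (h : Eqv n u (v ++ [a])) : Av n a u := by
  have hau : a ∈ u := h.symm.mem_of_mem hn ha (by simp)
  obtain ⟨Q, P, h1, hQ⟩ := List.eq_append_cons_of_mem (List.mem_reverse.2 hau)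
  obtain rfl : u = P.reverse ++ a :: Q.reverse := by
    rw [← List.reverse_reverse u, h1]
    simp
  refine ⟨_, _, rfl, fun c hc ↦ ⟨fun hca ↦ hQ (by simpa [hca] using hc), fun hac ↦ ?_⟩⟩
  have h2 := h a c hac
  rw [proj_append, proj_append, proj_cons_of_mem (Or.inl rfl), proj_cons_of_mem (Or.inl rfl)] at h2
  rcases List.eq_nil_or_concat (proj a c Q.reverse) with h3 | ⟨R, d, h3⟩
  · have : c ∈ proj a c Q.reverse := mem_proj.2 ⟨hc, Or.inr rfl⟩
    simp [h3] at this
  · have hd : d ∈ proj a c Q.reverse := by simp [h3]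
    have h4 : (proj a c P.reverse ++ a :: R) ++ [d] = proj a c v ++ [a] := by
      rw [← proj_nil a c, ← h2, h3]
      simp
    obtain rfl : d = a := by simpa using (List.append_inj' h4 rfl).2
    exact hQ (by simpa using (mem_proj.1 hd).1)

theorem Av.of_eqv {n a : ℕ} {u v : List ℕ} (hn : 1 ≤ n) (ha : a ≤ n) (hu : Av n a u)
    (h : Eqv n u v) : Av n a v := by
  obtain ⟨P, Q, rfl, h'⟩ := hu.exists_eqv
  exact (h.symm.trans h').av_of_concat hn ha

/-! ### A canonical representative -/

/-- At each position of the word, the letter is the greatest among those which can be commuted to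
this position from the left. -/
def LexMax (n : ℕ) (ω : List ℕ) : Prop :=
  ∀ (P : List ℕ) (b : ℕ) (S : List ℕ), ω = P ++ b :: S → ∀ a, Av n a (P ++ [b]) → a ≤ b

theorem lexMax_nil (n : ℕ) : LexMax n [] := by
  intro P b S h
  simp at h

theorem lexMax_concat {n b : ℕ} {u : List ℕ} :
    LexMax n (u ++ [b]) ↔ LexMax n u ∧ ∀ a, Av n a (u ++ [b]) → a ≤ b := by
  constructor
  · intro h
    exact ⟨fun P c S hu ↦ h P c (S ++ [b]) (by simp [hu]), h u b [] rfl⟩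
  · rintro ⟨h1, h2⟩ P c S h
    rcases List.eq_nil_or_concat S with rfl | ⟨S', d, rfl⟩
    · obtain ⟨rfl, h3⟩ := List.append_inj' h rfl
      obtain rfl : b = c := by simpa using h3
      exact h2
    · have h' : u ++ [b] = (P ++ c :: S') ++ [d] := by rw [h]; simp
      exact h1 P c S' (List.append_inj' h' rfl).1

/-- The last letter of each word is available in the other, so maximality makes the two equal;
cancel them and repeat. -/
theorem LexMax.eq_of_eqv {n : ℕ} (hn : 1 ≤ n) {u v : List ℕ} (hu : LexMax n u) (hv : LexMax n v)
    (hun : ∀ x ∈ u, x ≤ n) (hvn : ∀ x ∈ v, x ≤ n) (h : Eqv n u v) : u = v := by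
  induction u using List.reverseRecOn generalizing v with
  | nil =>
    have := (h.perm hn hun hvn).length_eq
    simpa [eq_comm] using this
  | append_singleton u a ih =>
    rcases List.eq_nil_or_concat v with rfl | ⟨v, b, rfl⟩
    · have := (h.perm hn hun hvn).length_eq
      simp at this
    · simp only [List.concat_eq_append] at *
      have h1 : a ≤ b := (lexMax_concat.1 hv).2 a (h.symm.av_of_concat hn (hun a (by simp)))
      have h2 : b ≤ a := (lexMax_concat.1 hu).2 b (h.av_of_concat hn (hvn b (by simp)))
      obtain rfl := le_antisymm h1 h2
      rw [ih (lexMax_concat.1 hu).1 (lexMax_concat.1 hv).1 (fun x hx ↦ hun x (by simp [hx]))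
        (fun x hx ↦ hvn x (by simp [hx])) h.cancel_right]

theorem exists_lexMax_eqv {n : ℕ} (hn : 1 ≤ n) (u : List ℕ) (hu : ∀ x ∈ u, x ≤ n) :
    ∃ v, Eqv n u v ∧ LexMax n v ∧ ∀ x ∈ v, x ≤ n := by
  induction hm : u.length generalizing u with
  | zero =>
    obtain rfl := List.length_eq_zero_iff.1 hm
    exact ⟨[], Eqv.refl n _, lexMax_nil n, by simp⟩
  | succ m ih =>
    have hex : ∃ a, Av n a u := by
      rcases List.eq_nil_or_concat u with rfl | ⟨v, b, rfl⟩
      · simp at hm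
      · exact ⟨b, by simpa using av_concat.2 (Or.inl rfl)⟩
    have hfin : {a | Av n a u}.Finite := (Set.finite_Iic n).subset fun a ha ↦ hu a ha.mem
    obtain ⟨b, hb, hmax⟩ := Set.exists_max_image _ id hfin hex
    obtain ⟨P, Q, rfl, h⟩ := Av.exists_eqv hb
    obtain ⟨v, hv, hv', hvn⟩ := ih (P ++ Q) (fun x hx ↦ hu x (by grind)) (by
      simp at hm ⊢; omega)
    have hbn : b ≤ n := hu b (by simp)
    have hE := h.trans (hv.append (Eqv.refl n [b]))
    have hvb : ∀ x ∈ v ++ [b], x ≤ n := by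
      intro x hx
      rcases List.mem_append.1 hx with hx | hx
      · exact hvn x hx
      · rw [List.mem_singleton.1 hx]; exact hbn
    exact ⟨v ++ [b], hE, lexMax_concat.2 ⟨hv', fun a ha ↦
      hmax a (ha.of_eqv hn (hvb a ha.mem) hE.symm)⟩, hvb⟩

/-! ### The exchange property -/

section Exchange

open CoxeterSystem

variable {B W : Type*} [Group W] {M : CoxeterMatrix B} (cs : CoxeterSystem M W)

open scoped Classical in
/-- The permutation of `W × ℤ/2` by which a simple reflection `s` acts: it conjugates the first
component by `s` and changes the second one if the first one is `s`. -/
noncomputable def simplePerm (i : B) : Equiv.Perm (W × ZMod 2) :=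
  Function.Involutive.toPerm
    (fun p ↦ (cs.simple i * p.1 * cs.simple i, p.2 + if p.1 = cs.simple i then 1 else 0)) (by
      rintro ⟨x, z⟩
      have h : cs.simple i * x * cs.simple i = cs.simple i ↔ x = cs.simple i := by
        constructor
        · intro h
          have := congrArg (fun y ↦ cs.simple i * y * cs.simple i) h
          simpa [mul_assoc] using this
        · rintro rfl
          simp
      simp only [h, Prod.mk.injEq]
      refine ⟨by simp [mul_assoc], ?_⟩
      rw [add_assoc, CharTwo.add_self_eq_zero, add_zero])

open scoped Classical in
theorem simplePerm_apply (i : B) (x : W) (z : ZMod 2) :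
    simplePerm cs i (x, z) =
      (cs.simple i * x * cs.simple i, z + if x = cs.simple i then 1 else 0) := rfl

-- With `t = cs.simple j` and `s = cs.simple i`, the sum runs through the reflections `(ts)^q t`,
-- the ones met when the `2k` letters act one after another.
open scoped Classical in
theorem simplePerm_mul_pow_apply (i j : B) (k : ℕ) (x : W) (z : ZMod 2) :
    ((simplePerm cs i * simplePerm cs j) ^ k) (x, z) =
      ((cs.simple i * cs.simple j) ^ k * x * (cs.simple j * cs.simple i) ^ k,
        z + ∑ q ∈ Finset.range (2 * k),
          if x = (cs.simple j * cs.simple i) ^ q * cs.simple j then 1 else 0) := by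
  induction k generalizing x z with
  | zero => simp
  | succ k ih =>
    have h1 : cs.simple j * x * cs.simple j = cs.simple i ↔
        x = cs.simple j * cs.simple i * cs.simple j := by
      constructor
      · intro h
        rw [← h]
        simp [mul_assoc]
      · rintro rfl
        simp [mul_assoc]
    have h2 : ∀ q : ℕ, cs.simple i * (cs.simple j * x * cs.simple j) * cs.simple i =
          (cs.simple j * cs.simple i) ^ q * cs.simple j ↔
        x = (cs.simple j * cs.simple i) ^ (q + 1 + 1) * cs.simple j := by
      intro q
      rw [pow_succ (cs.simple j * cs.simple i) (q + 1), pow_succ' _ q]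
      constructor
      · intro h
        have := congrArg (fun y ↦ cs.simple j * (cs.simple i * y * cs.simple i) * cs.simple j) h
        simpa [mul_assoc] using this
      · rintro rfl
        simp [mul_assoc]
    rw [pow_succ, Equiv.Perm.mul_apply, Equiv.Perm.mul_apply, simplePerm_apply, simplePerm_apply,
      ih]
    simp only [h1, h2, Prod.mk.injEq]
    constructor
    · rw [pow_succ, pow_succ' (cs.simple j * cs.simple i)]
      simp only [mul_assoc]
    · rw [show 2 * (k + 1) = 2 * k + 1 + 1 by ring, Finset.sum_range_succ', Finset.sum_range_succ']
      simp only [zero_add, pow_one, pow_zero, one_mul]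
      abel

/-- For `k = M i j` the `2k` reflections in the sum have period `k`, so each is counted an even
number of times. -/
theorem simplePerm_isLiftable : M.IsLiftable (simplePerm cs) := by
  classical
  intro i j
  ext1 ⟨x, z⟩
  have hji : (cs.simple j * cs.simple i) ^ M i j = 1 := by
    rw [M.symmetric]
    exact cs.simple_mul_simple_pow j i
  rw [simplePerm_mul_pow_apply, cs.simple_mul_simple_pow, hji, two_mul, Finset.sum_range_add]
  simp only [pow_add, hji, one_mul, mul_one, CharTwo.add_self_eq_zero, add_zero]
  rfl

/-- The action of `W` on `W × ℤ/2` which records inversions modulo two. -/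
noncomputable def inversionAction : W →* Equiv.Perm (W × ZMod 2) :=
  cs.lift ⟨simplePerm cs, simplePerm_isLiftable cs⟩

-- The left side depends only on the group element. Hence so does the parity of the multiplicity of
-- `x` in the inversion sequence of any word for it.
open scoped Classical in
theorem inversionAction_wordProd (ω : List B) (x : W) (z : ZMod 2) :
    inversionAction cs (cs.wordProd ω) (x, z) =
      (cs.wordProd ω * x * (cs.wordProd ω)⁻¹, z + ((cs.rightInvSeq ω).count x : ℕ)) := by
  induction ω with
  | nil => simp
  | cons i ω ih =>
    have h : cs.wordProd ω * x * (cs.wordProd ω)⁻¹ = cs.simple i ↔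
        (cs.wordProd ω)⁻¹ * cs.simple i * cs.wordProd ω = x := by
      constructor
      · intro h
        rw [← h]
        group
      · rintro rfl
        group
    rw [cs.wordProd_cons, map_mul, Equiv.Perm.mul_apply, ih, inversionAction, lift_apply_simple,
      simplePerm_apply]
    simp only [h, rightInvSeq, Prod.mk.injEq, List.count_cons, beq_iff_eq]
    constructor
    · simp [mul_assoc]
    · push_cast
      ring

/-- Some reduced word for the same element ends in `i`, and there the reflection occurs exactly
once; by parity it occurs in the inversion sequence of `ω` too. -/
theorem exchange_right {ω : List B} (hω : cs.IsReduced ω) {i : B}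
    (h : cs.IsRightDescent (cs.wordProd ω) i) : cs.simple i ∈ cs.rightInvSeq ω := by
  classical
  obtain ⟨η, hη, hη'⟩ := cs.exists_isReduced (cs.wordProd ω * cs.simple i)
  have hprod : cs.wordProd (η ++ [i]) = cs.wordProd ω := by
    rw [cs.wordProd_append, ← hη']
    simp
  have hlen := cs.isRightDescent_iff.1 h
  have hred : cs.IsReduced (η.concat i) := by
    unfold CoxeterSystem.IsReduced at *
    rw [← hη'] at hη
    simp only [List.concat_eq_append, hprod, List.length_append, List.length_singleton]
    omega
  have hmem : cs.simple i ∈ cs.rightInvSeq (η.concat i) := by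
    rw [rightInvSeq_concat]
    simp
  have h1 := inversionAction_wordProd cs (η.concat i) (cs.simple i) 0
  have h2 := inversionAction_wordProd cs ω (cs.simple i) 0
  rw [List.count_eq_one_of_mem hred.nodup_rightInvSeq hmem, List.concat_eq_append, hprod, h2,
    Prod.mk.injEq] at h1
  by_contra hnot
  rw [List.count_eq_zero_of_not_mem hnot] at h1
  simp at h1

theorem exchange_left {ω : List B} (hω : cs.IsReduced ω) {i : B}
    (h : cs.IsLeftDescent (cs.wordProd ω) i) :
    ∃ k < ω.length, cs.simple i * cs.wordProd ω = cs.wordProd (ω.eraseIdx k) := by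
  have h1 : cs.simple i ∈ cs.rightInvSeq ω.reverse := by
    apply exchange_right cs hω.reverse
    rw [wordProd_reverse, isRightDescent_inv_iff]
    exact h
  rw [rightInvSeq_reverse, List.mem_reverse] at h1
  obtain ⟨k, hk, hk'⟩ := List.getElem_of_mem h1
  refine ⟨k, by simpa using hk, ?_⟩
  rw [← getD_leftInvSeq_mul_wordProd, List.getD_eq_getElem _ _ hk, hk']

end Exchange

/-! ### Coxeter systems whose diagram is part of a cycle -/

/-- The map `f` identifies the nodes of the diagram of `M` with nodes of the cycle `0, 1, …, n`, in
such a way that adjacency corresponds. -/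
structure IsCycleDiagram {B : Type*} (n : ℕ) (M : CoxeterMatrix B) (f : B → ℕ) : Prop where
  inj : Function.Injective f
  le : ∀ s, f s ≤ n
  comm : ∀ s t, s ≠ t → ¬Adj n (f s) (f t) → M s t = 2
  ne_two : ∀ s t, Adj n (f s) (f t) → M s t ≠ 2
  three : 2 ≤ n → ∀ s t, Adj n (f s) (f t) → M s t = 3

theorem isCycleDiagram_affineA {n : ℕ} (hn : 1 ≤ n) :
    IsCycleDiagram n (affineA n) (Fin.val : Fin (n + 1) → ℕ) := by
  have key : ∀ a b : Fin (n + 1), (a + 1 = b ∨ b + 1 = a) ↔ Adj n a b := by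
    intro a b
    have h1 : (1 : Fin (n + 1)).val = 1 := by
      rw [Fin.val_one', Nat.mod_eq_of_lt (by omega)]
    rw [Fin.ext_iff, Fin.ext_iff, Fin.val_add_eq_ite, Fin.val_add_eq_ite, h1]
    have ha := a.2
    have hb := b.2
    unfold Adj
    split_ifs <;> omega
  have hM : ∀ a b : Fin (n + 1), affineA n a b =
      if a = b then 1 else if n = 1 then 0 else if Adj n a b then 3 else 2 := by
    intro a b
    simp only [affineA, Matrix.of_apply, key]
  refine ⟨Fin.val_injective, fun s ↦ by omega, fun s t hst h ↦ ?_, fun s t h ↦ ?_,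
    fun h2 s t h ↦ ?_⟩
  · rw [hM, if_neg hst, if_neg, if_neg h]
    rintro rfl
    have := Fin.val_ne_of_ne hst
    unfold Adj at h
    omega
  · rw [hM, if_neg fun h' ↦ h.ne hn (by rw [h']), if_pos h]
    split_ifs <;> simp
  · rw [hM, if_neg fun h' ↦ h.ne hn (by rw [h']), if_neg (by omega), if_pos h]

/-- The diagram of type A is the cycle with the node `0` removed. -/
theorem isCycleDiagram_A (n : ℕ) :
    IsCycleDiagram n (CoxeterMatrix.A n) (fun i : Fin n ↦ (i : ℕ) + 1) := by
  have key : ∀ a b : Fin n, ((a : ℕ) + 1 = b ∨ (b : ℕ) + 1 = a) ↔ Adj n (a + 1) (b + 1) := by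
    intro a b
    have ha := a.2
    have hb := b.2
    unfold Adj
    omega
  have hM : ∀ a b : Fin n, CoxeterMatrix.A n a b =
      if a = b then 1 else if Adj n (a + 1) (b + 1) then 3 else 2 := by
    intro a b
    simp only [CoxeterMatrix.A, Matrix.of_apply, ← key]
    split_ifs <;> first | rfl | omega
  have hne : ∀ a b : Fin n, Adj n (a + 1) (b + 1) → a ≠ b := by
    rintro a _ h rfl
    unfold Adj at h
    omega
  refine ⟨fun a b h ↦ Fin.ext (by simpa using h), fun s ↦ by omega, fun s t hst h ↦ ?_,
    fun s t h ↦ ?_, fun h2 s t h ↦ ?_⟩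
  · rw [hM, if_neg hst, if_neg h]
  · rw [hM, if_neg (hne s t h), if_pos h]
    simp
  · rw [hM, if_neg (hne s t h), if_pos h]

section Diagram

variable {B W : Type*} [Group W] {M : CoxeterMatrix B} (cs : CoxeterSystem M W)

theorem simple_comm_of_eq_two {s t : B} (h : M s t = 2) :
    cs.simple s * cs.simple t = cs.simple t * cs.simple s := by
  have := cs.simple_mul_simple_pow s t
  rw [h, pow_two, mul_eq_one_iff_eq_inv] at this
  simpa using this

theorem simple_mul_wordProd_comm {s : B} {u : List B} (h : ∀ c ∈ u, M s c = 2) :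
    cs.simple s * cs.wordProd u = cs.wordProd u * cs.simple s := by
  induction u with
  | nil => simp
  | cons c u ih =>
    rw [cs.wordProd_cons, ← mul_assoc, simple_comm_of_eq_two cs (h c (by simp)), mul_assoc,
      ih fun d hd ↦ h d (by simp [hd]), mul_assoc]

theorem wordProd_eq_of_reflTransGen {ω ω' : List B}
    (h : Relation.ReflTransGen (CommMove M) ω ω') : cs.wordProd ω = cs.wordProd ω' := by
  induction h with
  | refl => rfl
  | tail _ h ih =>
    obtain ⟨u, v, s, t, hst, rfl, rfl⟩ := h
    rw [ih, cs.wordProd_append, cs.wordProd_append, cs.wordProd_cons, cs.wordProd_cons,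
      cs.wordProd_cons, cs.wordProd_cons, ← mul_assoc (cs.simple s),
      simple_comm_of_eq_two cs hst, mul_assoc]

theorem not_isReduced_of_square (P Q : List B) (x : B) : ¬cs.IsReduced (P ++ x :: x :: Q) := by
  intro h
  have h1 : cs.wordProd (P ++ x :: x :: Q) = cs.wordProd (P ++ Q) := by
    simp [cs.wordProd_append, cs.wordProd_cons]
  have h2 := cs.length_wordProd_le (P ++ Q)
  rw [← h1, h.eq] at h2
  simp at h2

theorem isReduced_of_eq {ω ω' : List B} (h : cs.IsReduced ω)
    (hp : cs.wordProd ω' = cs.wordProd ω) (hl : ω'.length ≤ ω.length) : cs.IsReduced ω' := by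
  have h1 := cs.length_wordProd_le ω'
  unfold CoxeterSystem.IsReduced at *
  rw [hp] at *
  omega

namespace IsCycleDiagram

variable {n : ℕ} {f : B → ℕ}

theorem eqv_of_reflTransGen (D : IsCycleDiagram n M f) {ω ω' : List B}
    (h : Relation.ReflTransGen (CommMove M) ω ω') : Eqv n (ω.map f) (ω'.map f) := by
  induction h with
  | refl => exact Eqv.refl n _
  | tail _ h ih =>
    obtain ⟨u, v, s, t, hst, rfl, rfl⟩ := h
    refine ih.trans ?_
    simp only [List.map_append, List.map_cons]
    refine (Eqv.refl n _).append (Eqv.swap_cons (fun h ↦ ?_) (fun h ↦ D.ne_two s t h hst) _)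
    obtain rfl := D.inj h
    simp at hst

theorem reflTransGen_append {u u' : List B} (P Q : List B)
    (h : Relation.ReflTransGen (CommMove M) u u') :
    Relation.ReflTransGen (CommMove M) (P ++ u ++ Q) (P ++ u' ++ Q) := by
  induction h with
  | refl => exact .refl
  | tail _ h ih =>
    obtain ⟨u, v, s, t, hst, rfl, rfl⟩ := h
    exact ih.tail ⟨P ++ u, v ++ Q, s, t, hst, by simp, by simp⟩

theorem reflTransGen_move {s : B} {u : List B} (h : ∀ c ∈ u, M s c = 2) :
    Relation.ReflTransGen (CommMove M) (s :: u) (u ++ [s]) := by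
  induction u with
  | nil => exact .refl
  | cons c u ih =>
    refine .head ⟨[], u, s, c, h c (by simp), rfl, rfl⟩ ?_
    simpa using reflTransGen_append [c] [] (ih fun d hd ↦ h d (by simp [hd]))

/-- The last letter of `ω'` is available in `ω`. Commute it to the end, cancel it on both sides, and
induct. -/
theorem reflTransGen_of_eqv (hn : 1 ≤ n) (D : IsCycleDiagram n M f) {ω ω' : List B}
    (h : Eqv n (ω.map f) (ω'.map f)) : Relation.ReflTransGen (CommMove M) ω ω' := by
  have hle : ∀ η : List B, ∀ x ∈ η.map f, x ≤ n := by
    intro η x hx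
    obtain ⟨b, -, rfl⟩ := List.mem_map.1 hx
    exact D.le b
  induction ω' using List.reverseRecOn generalizing ω with
  | nil =>
    have := (h.perm hn (hle _) (hle _)).length_eq
    simp only [List.length_map, List.length_nil, List.length_eq_zero_iff] at this
    rw [this]
  | append_singleton v b ih =>
    have h' := h
    rw [List.map_append, List.map_singleton] at h'
    obtain ⟨P', Q', hPQ, hQ⟩ := h'.av_of_concat hn (D.le b)
    obtain ⟨P, R, rfl, rfl, hR⟩ := List.map_eq_append_iff.1 hPQ
    obtain ⟨b', Q, rfl, hb, rfl⟩ := List.map_eq_cons_iff.1 hR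
    obtain rfl := D.inj hb
    have hQ' : ∀ c ∈ Q, M b' c = 2 := by
      intro c hc
      obtain ⟨h1, h2⟩ := hQ (f c) (List.mem_map_of_mem hc)
      exact D.comm _ _ (fun h ↦ h1 (by rw [h])) h2
    have h1 : Relation.ReflTransGen (CommMove M) (P ++ b' :: Q) ((P ++ Q) ++ [b']) := by
      simpa using reflTransGen_append P [] (reflTransGen_move hQ')
    have h2 := ((D.eqv_of_reflTransGen h1).symm.trans h)
    rw [List.map_append, List.map_append (l₁ := v)] at h2
    exact h1.trans (by simpa using reflTransGen_append [] [b'] (ih h2.cancel_right))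

theorem wordProd_eq_of_eqv (hn : 1 ≤ n) (D : IsCycleDiagram n M f) {ω ω' : List B}
    (h : Eqv n (ω.map f) (ω'.map f)) : cs.wordProd ω = cs.wordProd ω' :=
  wordProd_eq_of_reflTransGen cs (D.reflTransGen_of_eqv hn h)

theorem map_le (D : IsCycleDiagram n M f) (ω : List B) : ∀ x ∈ ω.map f, x ≤ n := by
  intro x hx
  obtain ⟨b, -, rfl⟩ := List.mem_map.1 hx
  exact D.le b

theorem length_eq_of_eqv (hn : 1 ≤ n) (D : IsCycleDiagram n M f) {ω ω' : List B}
    (h : Eqv n (ω.map f) (ω'.map f)) : ω.length = ω'.length := by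
  simpa using (h.perm hn (D.map_le _) (D.map_le _)).length_eq

theorem mul_three {s t : B} (h : M s t = 3) :
    cs.simple s * cs.simple t * cs.simple s = cs.simple t * cs.simple s * cs.simple t := by
  have := cs.simple_mul_simple_pow s t
  rw [h] at this
  have h2 := congrArg (· * (cs.simple t * cs.simple s * cs.simple t)) this
  simpa [pow_succ, mul_assoc] using h2

/-- Take two occurrences of `x` at minimal distance without `y` in between, and let `z` be the other
neighbour. If `z` is absent, `x` commutes through and a square appears. If `z` occurs twice, it
gives a closer violation with `x` missing. If it occurs once, a braid move gives a reduced
expression with other letter counts, which commutations cannot reach. -/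
theorem alt_of_fullyCommutative (hn : 1 ≤ n) (D : IsCycleDiagram n M f) {ω : List B}
    (hω : cs.IsReduced ω) (hw : cs.wordProd ω ∈ fullyCommutative cs) : Alt n (ω.map f) := by
  have key : ∀ (m : ℕ) (P u Q : List B) (x : B) (y : ℕ), u.length = m → ω = P ++ x :: u ++ x :: Q →
      Adj n (f x) y → y ∈ u.map f := by
    intro m
    induction m using Nat.strong_induction_on with
    | _ m ih =>
      rintro P u Q x y rfl hω' hxy
      by_contra hyu
      have hxu : x ∉ u := by
        intro hx
        obtain ⟨u₁, u₂, rfl⟩ := List.append_of_mem hx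
        exact hyu (by
          have := ih u₁.length (by simp) P u₁ (u₂ ++ x :: Q) x y rfl (by simp [hω']) hxy
          simp [this])
      -- For `n = 1` both neighbours coincide and `z = y`; the braid relation of order three is
      -- needed only when `z ≠ y`.
      obtain ⟨z, hz, hzy⟩ : ∃ z, (∀ v, Adj n (f x) v → v = y ∨ v = z) ∧
          (z ≠ y → 2 ≤ n ∧ Adj n (f x) z) := by
        have hx := D.le x
        by_cases h : y = f x + 1
        · by_cases h0 : f x = 0
          · exact ⟨n, by unfold Adj at *; omega, by unfold Adj at *; omega⟩
          · exact ⟨f x - 1, by unfold Adj at *; omega, by unfold Adj at *; omega⟩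
        · by_cases h0 : f x = 0
          · exact ⟨1, by unfold Adj at *; omega, by unfold Adj at *; omega⟩
          · by_cases h1 : f x = n
            · by_cases h2 : y = 0
              · exact ⟨n - 1, by unfold Adj at *; omega, by unfold Adj at *; omega⟩
              · exact ⟨0, by unfold Adj at *; omega, by unfold Adj at *; omega⟩
            · exact ⟨f x + 1, by unfold Adj at *; omega, by unfold Adj at *; omega⟩
      have hcomm : ∀ v : List B, (∀ c ∈ v, c ∈ u) → z ∉ v.map f →
          cs.simple x * cs.wordProd v = cs.wordProd v * cs.simple x := by
        intro v hv hzv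
        refine simple_mul_wordProd_comm cs fun c hc ↦ D.comm _ _ ?_ fun h ↦ ?_
        · rintro rfl
          exact hxu (hv _ hc)
        · rcases hz _ h with h | h
          · exact hyu (h ▸ List.mem_map_of_mem (hv c hc))
          · exact hzv (h ▸ List.mem_map_of_mem hc)
      by_cases hzu : z ∈ u.map f
      · obtain ⟨hn2, hxz⟩ := hzy fun h ↦ hyu (h ▸ hzu)
        obtain ⟨c, hcu, rfl⟩ := List.mem_map.1 hzu
        obtain ⟨u₁, u₂, rfl, hc1⟩ := List.eq_append_cons_of_mem hcu
        by_cases hc2 : c ∈ u₂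
        · obtain ⟨u₃, u₄, rfl⟩ := List.append_of_mem hc2
          have := ih u₃.length (by simp; omega) (P ++ x :: u₁) u₃ (u₄ ++ x :: Q) c (f x) rfl
            (by simp [hω']) hxz.symm
          obtain ⟨x', hx', hx''⟩ := List.mem_map.1 this
          obtain rfl := D.inj hx''
          exact hxu (by simp [hx'])
        · have hf : ∀ v : List B, c ∉ v → f c ∉ v.map f := by
            intro v hv h
            obtain ⟨d, hd, hd'⟩ := List.mem_map.1 h
            exact hv (D.inj hd' ▸ hd)
          have e1 := hcomm u₁ (by simp +contextual) (hf _ hc1)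
          have e2 := hcomm u₂ (by simp +contextual) (hf _ hc2)
          have e3 := mul_three cs (D.three hn2 x c hxz)
          have hprod : cs.wordProd (P ++ u₁ ++ c :: x :: c :: u₂ ++ Q) = cs.wordProd ω := by
            rw [hω']
            simp only [cs.wordProd_append, cs.wordProd_cons, mul_assoc]
            simp only [mul_assoc] at e3
            congr 1
            rw [← mul_assoc (cs.simple x) (cs.wordProd u₁), e1, mul_assoc]
            congr 1
            rw [← mul_assoc (cs.wordProd u₂), ← e2]
            simp only [← mul_assoc] at e3 ⊢
            rw [e3]
          have hred := isReduced_of_eq cs hω hprod (by rw [hω']; simp; omega)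
          have hc := (D.eqv_of_reflTransGen (hw ω _ hω rfl hred hprod)).count_eq hn (D.le x)
          have hcx : f c ≠ f x := (hxz.ne hn).symm
          rw [hω'] at hc
          simp [hcx] at hc
          omega
      · have e := hcomm u (by simp) hzu
        refine not_isReduced_of_square cs (P ++ u) Q x (isReduced_of_eq cs hω ?_ ?_)
        · rw [hω']
          simp only [cs.wordProd_append, cs.wordProd_cons, mul_assoc]
          rw [← mul_assoc (cs.simple x) (cs.wordProd u), e, mul_assoc]
        · rw [hω']
          simp
          omega
  intro P' u' Q' x' y h hxy
  obtain ⟨R, S, rfl, hR, hS⟩ := List.map_eq_append_iff.1 h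
  obtain ⟨P, T, rfl, rfl, hT⟩ := List.map_eq_append_iff.1 hR
  obtain ⟨x, u, rfl, rfl, rfl⟩ := List.map_eq_cons_iff.1 hT
  obtain ⟨x₂, Q, rfl, hx, rfl⟩ := List.map_eq_cons_iff.1 hS
  obtain rfl := D.inj hx
  exact key _ P u Q _ y rfl (by simp) hxy

end IsCycleDiagram

end Diagram

/-! ### Alternating words are reduced expressions of fully commutative elements -/

/-- Sending the node `i` to the transposition of `i` and `i + 1` in the cyclic group of order `n + 1
≥ 3` respects the relations and separates the generators. -/
theorem csAff_simple_injective {n : ℕ} (hn : 2 ≤ n) :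
    Function.Injective (csAff n).simple := by
  have h1 : (1 : Fin (n + 1)) ≠ 0 := by
    rw [Ne, Fin.ext_iff, Fin.val_one', Nat.mod_eq_of_lt (by omega)]
    simp
  have h2 : (1 + 1 : Fin (n + 1)) ≠ 0 := by
    rw [Ne, Fin.ext_iff, Fin.val_add_eq_ite, Fin.val_one', Nat.mod_eq_of_lt (by omega)]
    split_ifs <;> simp
    omega
  have hs : ∀ i : Fin (n + 1), i + 1 ≠ i := fun i h ↦ h1 (by simpa using h)
  have hss : ∀ i : Fin (n + 1), i + 1 + 1 ≠ i := fun i h ↦ h2 (by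
    rw [add_assoc] at h
    simpa using h)
  have h3 : ∀ i : Fin (n + 1),
      (Equiv.swap i (i + 1) * Equiv.swap (i + 1) (i + 1 + 1)) ^ 3 = 1 := by
    intro i
    rw [Equiv.swap_comm i,
      ← (Equiv.Perm.isThreeCycle_swap_mul_swap_same (hs i) (hs (i + 1)).symm (hss i).symm).orderOf,
      pow_orderOf_eq_one]
  have hlift : (affineA n).IsLiftable fun i ↦ Equiv.swap i (i + 1) := by
    intro i j
    simp only [affineA, Matrix.of_apply]
    split_ifs with e1 e2 e3
    · subst e1
      simp
    · simp
    · rcases e3 with rfl | rfl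
      · exact h3 i
      · rw [← inv_inj, ← inv_pow, mul_inv_rev, Equiv.swap_inv, Equiv.swap_inv, inv_one]
        exact h3 j
    · push Not at e3
      have hd : Equiv.Perm.Disjoint (Equiv.swap i (i + 1)) (Equiv.swap j (j + 1)) := by
        intro x
        by_cases hi : x = i ∨ x = i + 1
        · right
          apply Equiv.swap_apply_of_ne_of_ne
          · rintro rfl
            rcases hi with h | h
            · exact e1 h.symm
            · exact e3.1 h.symm
          · rintro rfl
            rcases hi with h | h
            · exact e3.2 h
            · exact e1 (by simpa using h.symm)
        · left
          push Not at hi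
          exact Equiv.swap_apply_of_ne_of_ne hi.1 hi.2
      rw [hd.commute.mul_pow, pow_two, pow_two, Equiv.swap_mul_self, Equiv.swap_mul_self, one_mul]
  intro i j hij
  have h := congrArg ((csAff n).lift ⟨_, hlift⟩) hij
  rw [CoxeterSystem.lift_apply_simple, CoxeterSystem.lift_apply_simple] at h
  by_contra hne
  have h4 := congrArg (fun σ ↦ σ i) h
  simp only [Equiv.swap_apply_left] at h4
  by_cases hj : i = j + 1
  · rw [hj, Equiv.swap_apply_right] at h4
    exact hss j h4
  · rw [Equiv.swap_apply_of_ne_of_ne hne hj] at h4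
    exact hs i h4

/-- The generators act as the reflections `x ↦ -x` and `x ↦ 4 - x`. Only the involution relations
have to be checked, because the other entry of the matrix is `0`. -/
theorem subLeft_isLiftable :
    (affineA 1).IsLiftable fun i ↦ Equiv.subLeft (if i = 0 then 0 else 4 : ℤ) := by
  intro i j
  by_cases h : i = j
  · subst h
    ext x
    simp
  · simp [affineA, h]

/-- The action of `W(Ã_1)` on `ℤ` generated by two reflections. -/
noncomputable def dihedralAction : WAff 1 →* Equiv.Perm ℤ :=
  (csAff 1).lift ⟨_, subLeft_isLiftable⟩

theorem dihedralAction_simple (i : Fin 2) (x : ℤ) :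
    dihedralAction ((csAff 1).simple i) x = (if i = 0 then 0 else 4) - x := by
  rw [dihedralAction, (csAff 1).lift_apply_simple subLeft_isLiftable]
  rfl

/-- Ping-pong from the base point `1`: each reflection throws the far side of the other one to its
own far side, so the letter applied last, the head, is visible in the image. -/
theorem dihedralAction_wordProd (ω : List (Fin 2)) (h : ω.IsChain (· ≠ ·)) :
    (ω.head? = some 0 → dihedralAction ((csAff 1).wordProd ω) 1 ≤ -1) ∧
    (ω.head? = some 1 → 3 ≤ dihedralAction ((csAff 1).wordProd ω) 1) := by
  induction ω with
  | nil => simp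
  | cons i ω ih =>
    have ih := ih h.of_cons
    have hhead : ∀ j ∈ ω.head?, i ≠ j := by
      rw [List.isChain_cons] at h
      exact h.1
    have hact : dihedralAction ((csAff 1).wordProd (i :: ω)) 1 =
        (if i = 0 then 0 else 4) - dihedralAction ((csAff 1).wordProd ω) 1 := by
      rw [(csAff 1).wordProd_cons, map_mul, Equiv.Perm.mul_apply, dihedralAction_simple]
    rw [hact]
    rcases ω with _ | ⟨j, ω⟩
    · fin_cases i <;> simp [CoxeterSystem.wordProd_nil]
    · have hij := hhead j rfl
      fin_cases i <;> fin_cases j <;> simp at hij ih ⊢ <;> omega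

theorem isChain_ne_of_isReduced {B W : Type*} [Group W] {M : CoxeterMatrix B}
    (cs : CoxeterSystem M W) {ω : List B} (h : cs.IsReduced ω) : ω.IsChain (· ≠ ·) := by
  rw [List.isChain_iff_forall_rel_of_append_cons_cons]
  rintro a _ P Q rfl rfl
  exact not_isReduced_of_square cs P Q a h

theorem head_eq_of_isReduced {s t : Fin 2} {u v : List (Fin 2)} (hu : (csAff 1).IsReduced (s :: u))
    (hv : (csAff 1).IsReduced (t :: v))
    (h : (csAff 1).wordProd (s :: u) = (csAff 1).wordProd (t :: v)) : s = t := by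
  have h1 := dihedralAction_wordProd _ (isChain_ne_of_isReduced (csAff 1) hu)
  have h2 := dihedralAction_wordProd _ (isChain_ne_of_isReduced (csAff 1) hv)
  rw [h] at h1
  fin_cases s <;> fin_cases t <;> simp at h1 h2 ⊢ <;> omega

theorem isReduced_tail {B W : Type*} [Group W] {M : CoxeterMatrix B}
    {cs : CoxeterSystem M W} {s : B} {ω : List B} (h : cs.IsReduced (s :: ω)) :
    cs.IsReduced ω := h.drop 1

/-- Reducedness: if `s` shortened the rest `ω`, then by induction `ω` would be equivalent to a word
`s :: η`, and `s :: s :: η` does not alternate. Uniqueness: let `t :: η` be another reduced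
expression with `t ≠ s`. Exchange rewrites the element as `t s ζ`. If `s` and `t` commute, the
induction hypothesis applies to the tails; if they are adjacent, a second exchange would yield an
equivalent word `s t s ξ`, in which the other neighbour of `s` is missing between the two `s`. -/
theorem Alt.isReduced_and_eqv {n : ℕ} (hn : 1 ≤ n) {ω : List (Fin (n + 1))}
    (hω : Alt n (ω.map Fin.val)) :
    (csAff n).IsReduced ω ∧ ∀ η, (csAff n).IsReduced η →
      (csAff n).wordProd η = (csAff n).wordProd ω → Eqv n (η.map Fin.val) (ω.map Fin.val) := by
  have D := isCycleDiagram_affineA hn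
  induction hm : ω.length using Nat.strong_induction_on generalizing ω with
  | _ m ih =>
    rcases ω with _ | ⟨s, ω⟩
    · refine ⟨by simp [CoxeterSystem.IsReduced], fun η hη h ↦ ?_⟩
      unfold CoxeterSystem.IsReduced at hη
      rw [h] at hη
      simp only [CoxeterSystem.wordProd_nil, CoxeterSystem.length_one] at hη
      rw [List.length_eq_zero_iff.1 hη.symm]
      exact Eqv.refl n _
    simp only [List.length_cons] at hm
    have hω1 : Alt n (ω.map Fin.val) := hω.of_cons
    obtain ⟨hr1, he1⟩ := ih _ (by omega) hω1 rfl
    obtain ⟨y, hy⟩ := exists_adj hn (D.le s)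
    have hnot : ∀ v : List (Fin (n + 1)), ¬Alt n ((s :: s :: v).map Fin.val) := fun v h ↦ by
      simpa using h [] [] (v.map Fin.val) s.val y rfl hy
    have hred : (csAff n).IsReduced (s :: ω) := by
      have h1 := (csAff n).length_simple_mul ((csAff n).wordProd ω) s
      rcases h1 with h1 | h1
      · unfold CoxeterSystem.IsReduced at *
        rw [(csAff n).wordProd_cons, h1, hr1, List.length_cons]
      · obtain ⟨η, hη, hη'⟩ := (csAff n).exists_isReduced
          ((csAff n).simple s * (csAff n).wordProd ω)
        have hp : (csAff n).wordProd (s :: η) = (csAff n).wordProd ω := by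
          rw [(csAff n).wordProd_cons, ← hη', CoxeterSystem.simple_mul_simple_cancel_left]
        have h2 : (csAff n).IsReduced (s :: η) := by
          unfold CoxeterSystem.IsReduced at *
          rw [← hη'] at hη
          rw [hp, List.length_cons]
          omega
        exact absurd (hω.eqv ((he1 _ h2 hp).symm.cons s.val)) (hnot η)
    refine ⟨hred, fun η hη h ↦ ?_⟩
    have hlen : η.length = ω.length + 1 := by
      rw [← hη.eq, h, hred.eq, List.length_cons]
    rcases η with _ | ⟨t, η⟩
    · simp at hlen
    simp only [List.length_cons, add_left_inj] at hlen
    have hη1 := isReduced_tail hη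
    by_cases hst : t = s
    · subst hst
      exact (he1 η hη1 (by simpa [CoxeterSystem.wordProd_cons] using h)).cons t.val
    -- For `n = 1` the first letter of a reduced word is determined by the element, so `t ≠ s`
    -- cannot happen.
    have hn2 : 2 ≤ n := by
      by_contra hn2
      obtain rfl : n = 1 := by omega
      exact hst (head_eq_of_isReduced hη hred h)
    have hstW : (csAff n).simple t ≠ (csAff n).simple s :=
      fun h ↦ hst (csAff_simple_injective hn2 h)
    have hdt : (csAff n).IsLeftDescent ((csAff n).wordProd (s :: ω)) t := by
      unfold CoxeterSystem.IsLeftDescent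
      rw [← h, hη.eq, (csAff n).wordProd_cons, CoxeterSystem.simple_mul_simple_cancel_left, hη1.eq]
      simp
    obtain ⟨k, hk, hk'⟩ := exchange_left _ hred hdt
    rcases k with _ | k
    · refine absurd ?_ hstW
      rw [List.eraseIdx_cons_zero, (csAff n).wordProd_cons, ← mul_assoc, mul_eq_right,
        mul_eq_one_iff_eq_inv, (csAff n).inv_simple] at hk'
      exact hk'
    simp only [List.length_cons, add_lt_add_iff_right] at hk
    rw [List.eraseIdx_cons_succ] at hk'
    have hlen3 : (ω.eraseIdx k).length + 1 = ω.length := List.length_eraseIdx_add_one hk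
    generalize ω.eraseIdx k = ζ at hk' hlen3
    have hprod : (csAff n).wordProd (t :: s :: ζ) = (csAff n).wordProd (s :: ω) := by
      rw [(csAff n).wordProd_cons t, ← hk', (csAff n).simple_mul_simple_cancel_left]
    by_cases hM : affineA n s t = 2
    · have hp : (csAff n).wordProd (t :: ζ) = (csAff n).wordProd ω := by
        apply mul_left_cancel (a := (csAff n).simple s)
        rw [← (csAff n).wordProd_cons s ω, ← hprod, (csAff n).wordProd_cons, ← mul_assoc,
          simple_comm_of_eq_two _ hM, mul_assoc, ← (csAff n).wordProd_cons,
          ← (csAff n).wordProd_cons]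
      have e1 := he1 (t :: ζ) (isReduced_of_eq _ hr1 hp (by simp; omega)) hp
      have e2 : Eqv n ((t :: s :: ζ).map Fin.val) ((s :: ω).map Fin.val) :=
        (Eqv.swap_cons (fun h ↦ hst (Fin.ext h)) (fun h ↦ D.ne_two s t h.symm hM) _).trans
          (e1.cons s.val)
      have hA : Alt n ((s :: ζ).map Fin.val) := (hω.eqv e2.symm).of_cons
      have e3 := (ih ω.length (by omega) hA (by simpa using hlen3)).2 η hη1 (by
        rw [← hk', ← h, (csAff n).wordProd_cons, (csAff n).simple_mul_simple_cancel_left])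
      exact (e3.cons t.val).trans e2
    · have hadj : Adj n s t := by
        by_contra hadj
        exact hM (D.comm s t (Ne.symm hst) hadj)
      have h3 := IsCycleDiagram.mul_three (csAff n) (D.three hn2 s t hadj)
      have hred2 : (csAff n).IsReduced (t :: s :: ζ) :=
        isReduced_of_eq _ hred hprod (by simp; omega)
      have hds : (csAff n).IsLeftDescent ((csAff n).wordProd (t :: s :: ζ)) s := by
        unfold CoxeterSystem.IsLeftDescent
        rw [hprod, hred.eq, (csAff n).wordProd_cons, CoxeterSystem.simple_mul_simple_cancel_left,
          hr1.eq]
        simp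
      obtain ⟨l, hl, hl'⟩ := exchange_left _ hred2 hds
      rw [hprod, (csAff n).wordProd_cons, CoxeterSystem.simple_mul_simple_cancel_left] at hl'
      rcases l with _ | _ | l
      -- Deleting `t` would leave the element with the too short expression `ζ`.
      · exfalso
        have hp : (csAff n).wordProd (s :: ω) = (csAff n).wordProd ζ := by
          rw [(csAff n).wordProd_cons, hl', List.eraseIdx_cons_zero, (csAff n).wordProd_cons,
            CoxeterSystem.simple_mul_simple_cancel_left]
        have h5 := (csAff n).length_wordProd_le ζ
        rw [← hp, hred.eq, List.length_cons] at h5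
        omega
      -- Deleting `s` would make `s` and `t` commute, against the braid relation.
      · exfalso
        rw [List.eraseIdx_cons_succ, List.eraseIdx_cons_zero] at hl'
        have hts : (csAff n).simple t * (csAff n).simple s =
            (csAff n).simple s * (csAff n).simple t := by
          rw [(csAff n).wordProd_cons s ω, hl'] at hprod
          simp only [(csAff n).wordProd_cons, ← mul_assoc] at hprod
          exact mul_right_cancel hprod
        rw [← hts, mul_assoc, (csAff n).simple_mul_simple_self, mul_one] at h3
        rw [hts, mul_assoc, (csAff n).simple_mul_simple_self, mul_one] at h3
        exact hstW h3
      · simp only [List.length_cons, add_lt_add_iff_right] at hl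
        rw [List.eraseIdx_cons_succ, List.eraseIdx_cons_succ] at hl'
        have hlen4 : (ζ.eraseIdx l).length + 1 = ζ.length := List.length_eraseIdx_add_one hl
        generalize ζ.eraseIdx l = ξ at hl' hlen4
        have e1 := he1 _ (isReduced_of_eq _ hr1 hl'.symm (by simp; omega)) hl'.symm
        have hA : Alt n (s.val :: t.val :: s.val :: ξ.map Fin.val) :=
          hω.eqv (e1.symm.cons s.val)
        obtain ⟨z, hz, hzt⟩ : ∃ z, Adj n s z ∧ z ≠ t := by
          have hs := D.le s
          by_cases h1 : t.val = s + 1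
          · by_cases h0 : s.val = 0
            · exact ⟨n, by unfold Adj; omega, by omega⟩
            · exact ⟨s - 1, by unfold Adj; omega, by omega⟩
          · by_cases h2 : s.val = n
            · by_cases h0 : t.val = 0
              · exact ⟨n - 1, by unfold Adj; omega, by omega⟩
              · exact ⟨0, by unfold Adj; omega, by omega⟩
            · exact ⟨s + 1, by unfold Adj; omega, by omega⟩
        exact absurd (hA [] [t.val] (ξ.map Fin.val) s z rfl hz) (by simpa using hzt)

theorem Alt.isReduced {n : ℕ} (hn : 1 ≤ n) {ω : List (Fin (n + 1))}
    (hω : Alt n (ω.map Fin.val)) : (csAff n).IsReduced ω :=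
  (hω.isReduced_and_eqv hn).1

theorem Alt.mem_WcAff {n : ℕ} (hn : 1 ≤ n) {ω : List (Fin (n + 1))}
    (hω : Alt n (ω.map Fin.val)) : (csAff n).wordProd ω ∈ WcAff n := by
  intro η η' h1 h2 h3 h4
  have h := (hω.isReduced_and_eqv hn).2
  exact (isCycleDiagram_affineA hn).reflTransGen_of_eqv hn ((h η h1 h2).trans (h η' h3 h4).symm)

theorem alt_of_mem_WcAff {n : ℕ} (hn : 1 ≤ n) {ω : List (Fin (n + 1))} (hω : (csAff n).IsReduced ω)
    (hw : (csAff n).wordProd ω ∈ WcAff n) : Alt n (ω.map Fin.val) :=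
  (isCycleDiagram_affineA hn).alt_of_fullyCommutative _ hn hω hw

theorem eqv_of_mem_WcAff {n : ℕ} (hn : 1 ≤ n) {ω ω' : List (Fin (n + 1))}
    (hω : (csAff n).IsReduced ω) (hω' : (csAff n).IsReduced ω')
    (h : (csAff n).wordProd ω = (csAff n).wordProd ω') (hw : (csAff n).wordProd ω ∈ WcAff n) :
    Eqv n (ω.map Fin.val) (ω'.map Fin.val) :=
  (isCycleDiagram_affineA hn).eqv_of_reflTransGen (hw ω ω' hω rfl hω' h.symm)

/-! ### The shape of the canonical representatives -/

theorem mem_desc {i j x : ℕ} : x ∈ desc i j ↔ j ≤ x ∧ x ≤ i := by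
  simp [desc]

theorem mem_asc {i j x : ℕ} : x ∈ asc i j ↔ i ≤ x ∧ x ≤ j := by
  simp [asc]

theorem desc_eq_nil {i j : ℕ} (h : i < j) : desc i j = [] := by
  simp [desc, List.Ico.eq_nil_of_le h]

theorem asc_eq_nil {i j : ℕ} (h : j < i) : asc i j = [] := by
  simp [asc, List.Ico.eq_nil_of_le h]

theorem desc_cons {i j : ℕ} (h : j ≤ i + 1) : desc (i + 1) j = (i + 1) :: desc i j := by
  rw [desc, desc, List.Ico.succ_top h]
  simp

theorem desc_self (i : ℕ) : desc i i = [i] := by simp [desc]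

theorem desc_concat {i j : ℕ} (h : j ≤ i) : desc i j = desc i (j + 1) ++ [j] := by
  rw [desc, desc, List.Ico.eq_cons (by omega)]
  simp

theorem asc_cons {i j : ℕ} (h : i ≤ j) : asc i j = i :: asc (i + 1) j := by
  rw [asc, asc, List.Ico.eq_cons (by omega)]

theorem desc_split {i j x : ℕ} (h1 : j ≤ x + 1) (h2 : x + 1 ≤ i) :
    desc i j = desc i (x + 2) ++ (x + 1) :: desc x j := by
  rw [desc, ← List.Ico.append_consecutive (m := x + 2) (by omega) (by omega),
    List.Ico.succ_top (n := j) (m := x + 1) h1]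
  simp [desc]

theorem asc_split {i j x : ℕ} (h1 : i ≤ x + 1) (h2 : x + 1 ≤ j) :
    asc i j = asc i x ++ (x + 1) :: asc (x + 2) j := by
  rw [asc, ← List.Ico.append_consecutive (m := x + 1) (by omega) (by omega),
    List.Ico.eq_cons (n := x + 1) (by omega)]
  simp [asc]

theorem mem_hWord {n i r x : ℕ} : x ∈ hWord n i r ↔ (1 ≤ x ∧ x ≤ i) ∨ (r ≤ x ∧ x ≤ n) := by
  simp [hWord, mem_desc, mem_asc]

theorem mem_blockWord {B : List (ℕ × ℕ)} {x : ℕ} :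
    x ∈ blockWord B ↔ ∃ b ∈ B, b.2 ≤ x ∧ x ≤ b.1 := by
  simp only [blockWord, List.mem_flatMap, mem_desc]

theorem blockWord_append (B B' : List (ℕ × ℕ)) :
    blockWord (B ++ B') = blockWord B ++ blockWord B' := by simp [blockWord]

theorem blockWord_cons (b : ℕ × ℕ) (B : List (ℕ × ℕ)) :
    blockWord (b :: B) = desc b.1 b.2 ++ blockWord B := by simp [blockWord]

theorem desc_eq_cons {i j : ℕ} (h : j ≤ i) : ∃ u, desc i j = i :: u := by
  rcases i with _ | i
  · obtain rfl : j = 0 := by omega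
    exact ⟨[], desc_self 0⟩
  · exact ⟨_, desc_cons h⟩

theorem exists_adj_up {n x : ℕ} (hx : x ≤ n) :
    ∃ y, Adj n x y ∧ (y = 0 ∨ y = x + 1) := by
  rcases Nat.lt_or_ge x n with h | h
  · exact ⟨x + 1, by unfold Adj; omega, by omega⟩
  · exact ⟨0, by unfold Adj; omega, by omega⟩

theorem IsStembridge.of_cons {n : ℕ} {b : ℕ × ℕ} {B : List (ℕ × ℕ)}
    (h : IsStembridge n (b :: B)) : IsStembridge n B :=
  ⟨h.1.of_cons, fun c hc ↦ h.2 c (by simp [hc])⟩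

/-- The blocks are the maximal runs descending by one. Alternation orders their ends: prepending `x`
inside the range of the first block would leave `x - 1` missing between two `x`; extending that
block to the top of a later one would leave the next letter up, cyclically, missing. -/
theorem exists_isStembridge {n : ℕ} {S : List ℕ} (hS : S.IsChain fun x y ↦ x < y ∨ x = y + 1)
    (hmem : ∀ x ∈ S, 1 ≤ x ∧ x ≤ n) (hA : Alt n S) : ∃ B, IsStembridge n B ∧ S = blockWord B := by
  induction S with
  | nil => exact ⟨[], ⟨by simp, by simp⟩, rfl⟩
  | cons x S ih =>
    obtain ⟨B, hB, rfl⟩ := ih hS.of_cons (fun y hy ↦ hmem y (by simp [hy])) hA.of_cons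
    have hx := hmem x (by simp)
    rcases B with _ | ⟨⟨l, g⟩, B⟩
    · exact ⟨[(x, x)], ⟨by simp, by simpa using hx⟩, by simp [blockWord, desc_self]⟩
    have hlg := hB.2 (l, g) (by simp)
    simp only at hlg
    have hB1 := (List.pairwise_cons.1 hB.1).1
    rw [blockWord_cons] at hS hA hmem
    simp only at hS hA hmem
    obtain ⟨u, hu⟩ := desc_eq_cons hlg.2.1
    have hxl : x < l ∨ x = l + 1 := by
      rw [hu, List.cons_append, List.isChain_cons_cons] at hS
      exact hS.1
    rcases hxl with hxl | rfl
    · have hxg : x < g := by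
        by_contra hxg
        obtain ⟨z, rfl⟩ : ∃ z, x = z + 1 := ⟨x - 1, by omega⟩
        rw [desc_split (x := z) (by omega) (by omega)] at hA
        have := hA [] (desc l (z + 2)) (desc z g ++ blockWord B) (z + 1) z (by simp)
          (by unfold Adj; omega)
        rw [mem_desc] at this
        omega
      refine ⟨(x, x) :: (l, g) :: B, ⟨List.pairwise_cons.2 ⟨?_, hB.1⟩, ?_⟩, ?_⟩
      · intro b hb
        rcases List.mem_cons.1 hb with rfl | hb
        · exact ⟨hxl, hxg⟩
        · have := hB1 b hb
          simp only at this ⊢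
          omega
      · intro b hb
        rcases List.mem_cons.1 hb with rfl | hb
        · simpa using hx
        · exact hB.2 b hb
      · simp [blockWord_cons, desc_self]
    · refine ⟨(l + 1, g) :: B, ⟨List.pairwise_cons.2 ⟨?_, (List.pairwise_cons.1 hB.1).2⟩, ?_⟩, ?_⟩
      · intro b hb
        have hb1 := hB1 b hb
        simp only at hb1 ⊢
        refine ⟨?_, hb1.2⟩
        by_contra hlt
        obtain ⟨B₁, B₂, rfl⟩ := List.append_of_mem hb
        obtain ⟨v, hv⟩ := desc_eq_cons (hB.2 b (by simp)).2.1
        have hbl : b.1 = l + 1 := by omega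
        obtain ⟨y, hy, hy'⟩ := exists_adj_up hx.2
        have hmem' := hA [] (desc l g ++ blockWord B₁) (v ++ blockWord B₂) (l + 1) y
          (by rw [blockWord_append, blockWord_cons, hv, hbl]; simp) hy
        rw [List.mem_append, mem_desc, mem_blockWord] at hmem'
        rcases hmem' with h | ⟨c, hc, h⟩
        · omega
        · have h1 := (hB.2 c (by simp [hc])).1
          have h2 := (List.pairwise_append.1 (List.pairwise_cons.1 hB.1).2).2.2 c hc b (by simp)
          omega
      · intro b hb
        rcases List.mem_cons.1 hb with rfl | hb
        · simp only
          omega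
        · exact hB.2 b (by simp [hb])
      · rw [blockWord_cons, blockWord_cons, desc_cons (by omega), List.cons_append]

/-- The hypothesis `hL` says that no letter can be moved behind the final `0`. The last letter `g ≥
2` of a block can be held back only by `g + 1`, or by `0` if `g = n`. So, from the right, every
block is a single letter and the letters are consecutive. The final clause bounds the preceding
block in the induction. -/
theorem blockWord_eq_asc {n : ℕ} {B : List (ℕ × ℕ)} (hn : 1 ≤ n) (hB : IsStembridge n B)
    (h2 : ∀ b ∈ B, 2 ≤ b.2)
    (hL : ∀ P x Q, blockWord B = P ++ x :: Q → ∃ c ∈ Q ++ [0], c = x ∨ Adj n x c) :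
    ∃ r, 2 ≤ r ∧ r ≤ n + 1 ∧ blockWord B = asc r n ∧ ∀ l ≤ n, (∀ b ∈ B, l < b.1) → l < r := by
  induction B with
  | nil =>
    exact ⟨n + 1, by omega, le_rfl, by rw [asc_eq_nil (by omega)]; rfl, fun l hl _ ↦ by omega⟩
  | cons b B ih =>
    obtain ⟨l, g⟩ := b
    obtain ⟨r, hr2, hrn, hr, hlr⟩ := ih hB.of_cons (fun b hb ↦ h2 b (by simp [hb])) (by
      intro P x Q h
      exact hL (desc l g ++ P) x Q (by rw [blockWord_cons, h]; simp))
    have hlg := hB.2 (l, g) (by simp)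
    have hg2 := h2 (l, g) (by simp)
    simp only at hlg hg2
    have hl := hlr l hlg.2.2 fun b hb ↦ ((List.pairwise_cons.1 hB.1).1 b hb).1
    obtain ⟨c, hc, hc'⟩ := hL (desc l (g + 1)) g (asc r n) (by
      rw [blockWord_cons, hr, desc_concat hlg.2.1]
      simp)
    have hgr : g + 1 = r := by
      rw [List.mem_append, mem_asc, List.mem_singleton] at hc
      unfold Adj at hc'
      omega
    obtain rfl : l = g := by omega
    refine ⟨l, hg2, by omega, ?_, fun m hm h ↦ h (l, l) (by simp)⟩
    rw [blockWord_cons, hr, asc_cons hlg.2.2, hgr]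
    simp [desc_self]

/-- Only the first block can reach down to `1`, where the final `0` holds it back; it becomes the
descending part, and the other blocks form the ascending part. -/
theorem exists_blockWord_eq_hWord {n : ℕ} {B : List (ℕ × ℕ)} (hn : 1 ≤ n) (hB : IsStembridge n B)
    (hL : ∀ P x Q, blockWord B = P ++ x :: Q → ∃ c ∈ Q ++ [0], c = x ∨ Adj n x c) :
    ∃ i r, i < r ∧ 2 ≤ r ∧ r ≤ n + 1 ∧ blockWord B = hWord n i r := by
  by_cases h2 : ∀ b ∈ B, 2 ≤ b.2
  · obtain ⟨r, hr2, hrn, hr, -⟩ := blockWord_eq_asc hn hB h2 hL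
    exact ⟨0, r, by omega, hr2, hrn, by rw [hr, hWord, desc_eq_nil (by omega)]; rfl⟩
  · rcases B with _ | ⟨⟨l, g⟩, B⟩
    · simp at h2
    have h2' : ∀ b ∈ B, 2 ≤ b.2 := by
      intro b hb
      have h3 := ((List.pairwise_cons.1 hB.1).1 b hb).2
      have h4 := (hB.2 (l, g) (by simp)).1
      simp only at h3 h4
      omega
    have hlg := hB.2 (l, g) (by simp)
    simp only at hlg
    obtain rfl : g = 1 := by
      simp only [List.mem_cons, forall_eq_or_imp] at h2
      by_contra hg
      exact h2 ⟨by omega, h2'⟩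
    obtain ⟨r, hr2, hrn, hr, hlr⟩ := blockWord_eq_asc hn hB.of_cons h2' (by
      intro P x Q h
      exact hL (desc l 1 ++ P) x Q (by rw [blockWord_cons, h]; simp))
    refine ⟨l, r, hlr l hlg.2.2 fun b hb ↦ ((List.pairwise_cons.1 hB.1).1 b hb).1, hr2, hrn, ?_⟩
    rw [blockWord_cons, hr, hWord]

/-- Commuting neighbours must increase by maximality. Adjacent ones differ by one, since the letter
`0` and with it the wrap-around is excluded. -/
theorem isChain_of_lexMax {n : ℕ} (hn : 1 ≤ n) {P S Q : List ℕ} (hA : Alt n (P ++ S ++ Q))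
    (hM : LexMax n (P ++ S ++ Q)) (hS : ∀ x ∈ S, 1 ≤ x ∧ x ≤ n) :
    S.IsChain fun x y ↦ x < y ∨ x = y + 1 := by
  rw [List.isChain_iff_forall_rel_of_append_cons_cons]
  rintro a b S₁ S₂ rfl
  have ha := hS a (by simp)
  have hb := hS b (by simp)
  by_cases hab : a = b
  · subst hab
    obtain ⟨y, hy⟩ := exists_adj hn ha.2
    simpa using hA (P ++ S₁) [] (S₂ ++ Q) a y (by simp) hy
  by_cases hadj : Adj n a b
  · unfold Adj at hadj
    omega
  · have := hM (P ++ S₁ ++ [a]) b (S₂ ++ Q) (by simp) a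
      ⟨P ++ S₁, [b], by simp, by simpa using ⟨Ne.symm hab, hadj⟩⟩
    omega

theorem exists_eq_hWord {n : ℕ} (hn : 1 ≤ n) {P S : List ℕ} (hA : Alt n (P ++ S ++ [0]))
    (hM : LexMax n (P ++ S ++ [0])) (hS : ∀ x ∈ S, 1 ≤ x ∧ x ≤ n) :
    ∃ i r, i < r ∧ 2 ≤ r ∧ r ≤ n + 1 ∧ S = hWord n i r := by
  obtain ⟨B, hB, rfl⟩ := exists_isStembridge (isChain_of_lexMax hn hA hM hS) hS
    (hA.infix ⟨P, [0], rfl⟩)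
  refine exists_blockWord_eq_hWord hn hB fun R x Q h ↦ ?_
  by_contra! hc
  have := hM (P ++ blockWord B) 0 [] (by simp) x ⟨P ++ R, Q ++ [0], by simp [h], hc⟩
  have := hS x (by simp [h])
  omega

/-- In h(i, r) the letter `x` of the descending part is followed only by smaller letters and by
letters at least `r`, so the required `x + 1` must come after the `0`. -/
theorem Alt.mem_of_low {n i r x : ℕ} {P Q R : List ℕ}
    (hA : Alt n (P ++ (hWord n i r ++ 0 :: (Q ++ x :: R)))) (h1 : 1 ≤ x) (hxi : x ≤ i)
    (hxr : x + 1 < r) (hr : r ≤ n + 1) : x + 1 ∈ Q := by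
  obtain ⟨z, rfl⟩ : ∃ z, x = z + 1 := ⟨x - 1, by omega⟩
  have := hA (P ++ desc i (z + 2)) (desc z 1 ++ asc r n ++ 0 :: Q) R (z + 1) (z + 1 + 1)
    (by rw [hWord, desc_split (x := z) (by omega) hxi]; simp) (by unfold Adj; omega)
  simp only [List.mem_append, mem_desc, mem_asc, List.mem_cons] at this
  rcases this with h | h | h
  · omega
  · omega
  · exact h

/-- In the ascending part `x` is followed only by greater letters, so the required `x - 1` must come
after the `0`. -/
theorem Alt.mem_of_high {n i r x : ℕ} {P Q R : List ℕ}
    (hA : Alt n (P ++ (hWord n i r ++ 0 :: (Q ++ x :: R)))) (h2 : 2 ≤ x) (hxr : r ≤ x)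
    (hxn : x ≤ n) : x - 1 ∈ Q := by
  obtain ⟨z, rfl⟩ : ∃ z, x = z + 1 := ⟨x - 1, by omega⟩
  have := hA (P ++ desc i 1 ++ asc r z) (asc (z + 2) n ++ 0 :: Q) R (z + 1) z
    (by rw [hWord, asc_split (x := z) hxr hxn]; simp) (by unfold Adj; omega)
  simp only [List.mem_append, mem_asc, List.mem_cons] at this
  rcases this with h | h | h
  · omega
  · omega
  · simpa using h

theorem hWord_split_low {n i r x : ℕ} (h1 : 1 ≤ x) (h : x ≤ i) :
    ∃ u v, hWord n i r = u ++ x :: v ∧ ∀ y ∈ u, x < y ∧ y ≤ i := by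
  obtain ⟨z, rfl⟩ : ∃ z, x = z + 1 := ⟨x - 1, by omega⟩
  refine ⟨desc i (z + 2), desc z 1 ++ asc r n, ?_, fun y hy ↦ ?_⟩
  · rw [hWord, desc_split (x := z) (by omega) h]
    simp
  · rw [mem_desc] at hy
    omega

theorem hWord_split_head {n i r : ℕ} (h : r ≤ n) :
    ∃ u v, hWord n i r = u ++ r :: v ∧ ∀ y ∈ u, y ≤ i := by
  refine ⟨desc i 1, asc (r + 1) n, ?_, fun y hy ↦ ?_⟩
  · rw [hWord, asc_cons h]
  · rw [mem_desc] at hy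
    omega

theorem Alt.ends_mem_hWord {n i r : ℕ} {P u : List ℕ} (hn : 1 ≤ n)
    (hA : Alt n (P ++ (u ++ 0 :: (hWord n i r ++ [0])))) :
    1 ∈ hWord n i r ∧ n ∈ hWord n i r :=
  ⟨hA (P ++ u) _ [] 0 1 (by simp) (by unfold Adj; omega),
    hA (P ++ u) _ [] 0 n (by simp) (by unfold Adj; omega)⟩

/-- Alternation of `0` puts `1` and `n` into the new piece. Its first low letter `i'` and its first
high letter `r'` would otherwise recur before the neighbour that must separate them from their
previous occurrence. -/
theorem Alt.hWord_step {n i r i' r' : ℕ} {P : List ℕ} (hn : 1 ≤ n)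
    (hA : Alt n (P ++ (hWord n i r ++ 0 :: (hWord n i' r' ++ [0])))) (hir : i + 2 ≤ r)
    (hr : r ≤ n + 1) (hi' : i' < r') (hr2 : 2 ≤ r') (hr' : r' ≤ n + 1) :
    i < i' ∧ (r' < r ∨ (i' + 1 = r' ∧ r' = r)) := by
  obtain ⟨hm1, hmn⟩ := hA.ends_mem_hWord hn
  rw [mem_hWord] at hm1 hmn
  have h1 : 1 ≤ i' := by omega
  have hii : i < i' := by
    by_contra hii
    obtain ⟨u, v, huv, hu⟩ := hWord_split_low (n := n) (r := r') h1 le_rfl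
    have := hu _ (Alt.mem_of_low (Q := u) (R := v ++ [0]) (by simpa [huv] using hA) h1
      (by omega) (by omega) hr)
    omega
  refine ⟨hii, ?_⟩
  by_contra hcon
  by_cases hfull : i' + 1 = r'
  · obtain ⟨u, v, huv, hu⟩ := hWord_split_low (n := n) (r := r') h1 le_rfl
    have := hu _ (Alt.mem_of_high (Q := u) (R := v ++ [0]) (by simpa [huv] using hA) (by omega)
      (by omega) (by omega))
    omega
  · obtain ⟨u, v, huv, hu⟩ := hWord_split_head (n := n) (i := i') (r := r') (by omega)
    have := hu _ (Alt.mem_of_high (Q := u) (R := v ++ [0]) (by simpa [huv] using hA) (by omega)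
      (by omega) (by omega))
    omega

/-- A piece containing all of `1, …, n` leaves no freedom for the next one; this is the source of
the power in the normal form. -/
theorem Alt.hWord_step_full {n j i' r' : ℕ} {P : List ℕ} (hn : 1 ≤ n)
    (hA : Alt n (P ++ (hWord n j (j + 1) ++ 0 :: (hWord n i' r' ++ [0])))) (hj : 1 ≤ j)
    (hjn : j ≤ n) (hi' : i' < r') (hr2 : 2 ≤ r') (hr' : r' ≤ n + 1) : i' = j ∧ r' = j + 1 := by
  obtain ⟨hm1, hmn⟩ := hA.ends_mem_hWord hn
  rw [mem_hWord] at hm1 hmn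
  have h1 : 1 ≤ i' := by omega
  obtain rfl : i' = j := by
    obtain ⟨u, v, huv, hu⟩ := hWord_split_low (n := n) (r := r') h1 le_rfl
    have hA' : Alt n (P ++ (hWord n j (j + 1) ++ 0 :: (u ++ i' :: (v ++ [0])))) := by
      simpa [huv] using hA
    rcases lt_trichotomy i' j with h | h | h
    · have := hu _ (hA'.mem_of_low h1 h.le (by omega) (by omega))
      omega
    · exact h
    · have := hu _ (hA'.mem_of_high (by omega) h (by omega))
      omega
  refine ⟨rfl, ?_⟩
  by_contra hne
  obtain ⟨u, v, huv, hu⟩ := hWord_split_head (n := n) (i := i') (r := r') (by omega)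
  have := hu _ (Alt.mem_of_high (Q := u) (R := v ++ [0]) (by simpa [huv] using hA) (by omega)
    (by omega) (by omega))
  omega

/-! ### Assembling the parameters of the normal form -/

theorem exists_split_last_zero (ω : List ℕ) :
    ∃ u S, ω = u ++ S ∧ 0 ∉ S ∧ (u = [] ∨ ∃ v, u = v ++ [0]) := by
  induction ω using List.reverseRecOn with
  | nil => exact ⟨[], [], rfl, by simp, Or.inl rfl⟩
  | append_singleton ω a ih =>
    obtain ⟨u, S, rfl, hS, hu⟩ := ih
    by_cases ha : a = 0
    · subst ha
      exact ⟨u ++ S ++ [0], [], by simp, by simp, Or.inr ⟨u ++ S, rfl⟩⟩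
    · exact ⟨u, S ++ [a], by simp, by simp [hS, Ne.symm ha], hu⟩

theorem formWord_succ (n : ℕ) (H : List (ℕ × ℕ)) (j k : ℕ) :
    formWord n H j (k + 1) [] = formWord n H j k [] ++ (hWord n j (j + 1) ++ [0]) := by
  simp [formWord, List.replicate_succ', blockWord]

theorem formWord_concat (n : ℕ) (H : List (ℕ × ℕ)) (q : ℕ × ℕ) (j : ℕ) :
    formWord n (H ++ [q]) j 0 [] = formWord n H j 0 [] ++ (hWord n q.1 q.2 ++ [0]) := by
  simp [formWord, blockWord]

theorem formWord_eq_append (n : ℕ) (H : List (ℕ × ℕ)) (j k : ℕ) (B : List (ℕ × ℕ)) :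
    formWord n H j k B = formWord n H j k [] ++ blockWord B := by
  simp [formWord, blockWord]

theorem IsNormalData.of_nil {n : ℕ} {H : List (ℕ × ℕ)} {j k : ℕ}
    (h1 : H.Pairwise (fun q q' ↦ q.1 < q'.1 ∧ q'.2 < q.2))
    (h2 : ∀ q ∈ H, q.1 + 2 ≤ q.2 ∧ q.2 ≤ n + 1) (h3 : 0 < k → 1 ≤ j ∧ j ≤ n)
    (h4 : 0 < k → ∀ q ∈ H.getLast?, (q.1 < j ∧ j + 1 < q.2) ∨ j + 1 = q.2) :
    IsNormalData n H j k [] :=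
  ⟨⟨by simp, by simp⟩, h1, h2, h3, h4, by simp, by simp, by simp⟩

theorem exists_isNormalData_of_concat {n : ℕ} (hn : 1 ≤ n) (ω : List ℕ) (hle : ∀ x ∈ ω, x ≤ n)
    (hA : Alt n ω) (hM : LexMax n ω) (hω : ω = [] ∨ ∃ v, ω = v ++ [0]) :
    ∃ H j k, IsNormalData n H j k [] ∧ ω = formWord n H j k [] := by
  induction hm : ω.length using Nat.strong_induction_on generalizing ω with
  | _ m ih =>
    rcases hω with rfl | ⟨v, rfl⟩
    · exact ⟨[], 0, 0, .of_nil (by simp) (by simp) (by simp) (by simp), rfl⟩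
    obtain ⟨u, S, rfl, hS0, hu⟩ := exists_split_last_zero v
    have hS : ∀ x ∈ S, 1 ≤ x ∧ x ≤ n := by
      intro x hx
      refine ⟨Nat.one_le_iff_ne_zero.2 fun h ↦ hS0 (h ▸ hx), hle x (by simp [hx])⟩
    obtain ⟨i, r, hir, hr2, hrn, rfl⟩ := exists_eq_hWord hn hA hM hS
    have hMu : LexMax n u := fun P b Q h ↦ hM P b (Q ++ hWord n i r ++ [0]) (by simp [h])
    obtain ⟨H, j, k, hd, rfl⟩ := ih u.length (by simp at hm; omega) u
      (fun x hx ↦ hle x (by simp [hx])) (hA.infix ⟨[], hWord n i r ++ [0], by simp⟩) hMu hu rfl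
    rcases k with _ | k
    · rcases List.eq_nil_or_concat H with rfl | ⟨H, q, rfl⟩
      -- A piece with `i + 1 = r` contains all of `1, …, n` and opens the periodic part, with `j =
      -- i`.
      · by_cases hfull : i + 1 = r
        · subst hfull
          refine ⟨[], i, 1, .of_nil (by simp) (by simp) (by omega) (by simp), ?_⟩
          rw [formWord_succ]
          simp [formWord]
        · refine ⟨[(i, r)], 0, 0, .of_nil (by simp) ?_ (by simp) (by simp),
            by simp [formWord, blockWord]⟩
          simp only [List.mem_singleton, forall_eq]
          omega
      · simp only [List.concat_eq_append] at *
        have hq := hd.gap q (by simp)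
        obtain ⟨h1, h2⟩ := Alt.hWord_step (P := formWord n H j 0 []) (i := q.1) (r := q.2) hn
          (by rw [formWord_concat] at hA; simpa using hA) hq.1 hq.2 hir hr2 hrn
        by_cases hfull : i + 1 = r
        · subst hfull
          refine ⟨H ++ [q], i, 1, .of_nil hd.nested hd.gap (by omega) ?_, ?_⟩
          · intro _ q' hq'
            obtain rfl : q = q' := by simpa using hq'
            omega
          · rw [formWord_succ]
            simp [formWord]
        · refine ⟨H ++ [q] ++ [(i, r)], j, 0, .of_nil ?_ ?_ (by simp) (by simp), ?_⟩
          · refine List.pairwise_append.2 ⟨hd.nested, by simp, ?_⟩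
            intro a ha b hb
            rw [List.mem_singleton.1 hb]
            rcases List.mem_append.1 ha with ha | ha
            · have := (List.pairwise_append.1 hd.nested).2.2 a ha q (by simp)
              simp only
              omega
            · rw [List.mem_singleton.1 ha]
              simp only
              omega
          · intro a ha
            rcases List.mem_append.1 ha with ha | ha
            · exact hd.gap a ha
            · rw [List.mem_singleton.1 ha]
              simp only
              omega
          · rw [formWord_concat n (H ++ [q])]
            simp
    · have hj := hd.j_mem (by omega)
      obtain ⟨rfl, rfl⟩ := Alt.hWord_step_full (P := formWord n H j k []) hn
        (by rw [formWord_succ] at hA; simpa using hA) hj.1 hj.2 hir hr2 hrn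
      exact ⟨H, i, k + 2, .of_nil hd.nested hd.gap (fun _ ↦ hj) (fun _ ↦ hd.last_pos (by omega)),
        by rw [formWord_succ n H i (k + 1)]; simp⟩

/-- The first letter of the right factor stands directly after `0`, so no separating neighbour fits
in between. -/
theorem Alt.right_head {n i r : ℕ} {P : List ℕ} {b : ℕ × ℕ} {B : List (ℕ × ℕ)}
    (hA : Alt n (P ++ (hWord n i r ++ [0]) ++ blockWord (b :: B))) (hB : IsStembridge n (b :: B))
    (hr : r ≤ n + 1) : ¬(b.1 ≤ i ∧ b.1 + 1 < r) ∧ ¬(r ≤ b.1 ∧ 2 ≤ b.1) := by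
  have hb := hB.2 b (by simp)
  obtain ⟨u, hu⟩ := desc_eq_cons hb.2.1
  have hA' : Alt n (P ++ (hWord n i r ++ 0 :: ([] ++ b.1 :: (u ++ blockWord B)))) := by
    rw [blockWord_cons, hu] at hA
    simpa using hA
  constructor
  · intro h
    simpa using hA'.mem_of_low (by omega) h.1 h.2 hr
  · intro h
    simpa using hA'.mem_of_high h.2 h.1 (by omega)

/-- If `b'.1 ≥ r`, then `b'.1 - 1` would have to occur in an earlier block, but those letters are at
most `b.1`. -/
theorem Alt.right_chain {n i r : ℕ} {P : List ℕ} {b b' : ℕ × ℕ} {B₁ B₂ : List (ℕ × ℕ)}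
    (hA : Alt n (P ++ (hWord n i r ++ [0]) ++ blockWord (B₁ ++ b :: b' :: B₂)))
    (hB : IsStembridge n (B₁ ++ b :: b' :: B₂)) (h : b.1 + 1 < b'.1) : b'.1 < r := by
  by_contra hlt
  have hb := hB.2 b' (by simp)
  obtain ⟨u, hu⟩ := desc_eq_cons hb.2.1
  have hA' : Alt n (P ++ (hWord n i r ++
      0 :: (blockWord (B₁ ++ [b]) ++ b'.1 :: (u ++ blockWord B₂)))) := by
    rw [show B₁ ++ b :: b' :: B₂ = B₁ ++ [b] ++ b' :: B₂ by simp, blockWord_append,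
      blockWord_cons b', hu] at hA
    simpa using hA
  obtain ⟨c, hc, hc'⟩ := mem_blockWord.1 (hA'.mem_of_high (by omega) (by omega) (by omega))
  rcases List.mem_append.1 hc with hc | hc
  · have := (List.pairwise_append.1 hB.1).2.2 c hc b (by simp)
    omega
  · rw [List.mem_singleton.1 hc] at hc'
    omega

theorem map_fst_eq_Ico {B : List (ℕ × ℕ)} {j : ℕ} (hh : ∀ b ∈ B.head?, b.1 = j)
    (hc : B.IsChain fun b b' ↦ b'.1 = b.1 + 1) :
    B.map Prod.fst = List.Ico j (j + B.length) := by
  induction B generalizing j with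
  | nil => simp
  | cons b B ih =>
    rw [List.isChain_cons] at hc
    have hb : b.1 = j := hh b rfl
    rw [List.map_cons, ih (j := j + 1) (fun c hc' ↦ by rw [hc.1 c hc', hb]) hc.2,
      List.Ico.eq_cons (n := j) (by simp), hb, List.length_cons]
    congr 2
    omega

theorem exists_isNormalData {n : ℕ} (hn : 1 ≤ n) {ω : List ℕ} (hle : ∀ x ∈ ω, x ≤ n)
    (hA : Alt n ω) (hM : LexMax n ω) :
    ∃ H j k B, IsNormalData n H j k B ∧ ω = formWord n H j k B := by
  obtain ⟨u, S, rfl, hS0, hu⟩ := exists_split_last_zero ω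
  have hS : ∀ x ∈ S, 1 ≤ x ∧ x ≤ n := by
    intro x hx
    refine ⟨Nat.one_le_iff_ne_zero.2 fun h ↦ hS0 (h ▸ hx), hle x (by simp [hx])⟩
  have hMu : LexMax n u := fun P b Q h ↦ hM P b (Q ++ S) (by simp [h])
  obtain ⟨H, j, k, hd, rfl⟩ := exists_isNormalData_of_concat hn u
    (fun x hx ↦ hle x (by simp [hx])) (hA.infix ⟨[], S, by simp⟩) hMu hu
  obtain ⟨B, hB, rfl⟩ := exists_isStembridge (isChain_of_lexMax (Q := []) hn (by simpa using hA)
    (by simpa using hM) hS) hS (hA.infix ⟨formWord n H j k [], [], by simp⟩)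
  refine ⟨H, j, k, B, ⟨hB, hd.nested, hd.gap, hd.j_mem, hd.last_pos, ?_, ?_, ?_⟩,
    (formWord_eq_append n H j k B).symm⟩
  · intro hk
    obtain ⟨k, rfl⟩ : ∃ k', k = k' + 1 := ⟨k - 1, by omega⟩
    have hj := hd.j_mem hk
    rw [formWord_succ] at hA
    have hhead : ∀ b ∈ B.head?, b.1 = j := by
      rcases B with _ | ⟨b, B⟩
      · simp
      · simp only [List.head?_cons, Option.mem_def, Option.some.injEq, forall_eq']
        have := hA.right_head hB (by omega)
        omega
    refine map_fst_eq_Ico hhead ?_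
    rw [List.isChain_iff_forall_rel_of_append_cons_cons]
    rintro b b' B₁ B₂ rfl
    have h1 := ((List.pairwise_cons.1 (List.pairwise_append.1 hB.1).2.1).1 b' (by simp)).1
    -- The chain condition bounds a jumping `b'.1` by `r = j + 1`; since `b'.1` exceeds `b.1 ≥ j`,
    -- no jump is possible.
    have h2 : j ≤ b.1 := by
      rcases B₁ with _ | ⟨c, B₁⟩
      · exact (hhead b rfl).ge
      · have h3 := hhead c rfl
        have h4 := ((List.pairwise_append.1 hB.1).2.2 c (by simp) b (by simp)).1
        omega
    by_contra hne
    have := hA.right_chain hB (by omega)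
    omega
  · rintro rfl q hq b hb
    obtain ⟨H, rfl⟩ := List.getLast?_eq_some_iff.1 hq
    obtain ⟨B, rfl⟩ := List.head?_eq_some_iff.1 hb
    rw [formWord_concat] at hA
    have hq := hd.gap q (by simp)
    have := hA.right_head hB hq.2
    omega
  · rintro rfl q hq
    obtain ⟨H, rfl⟩ := List.getLast?_eq_some_iff.1 hq
    rw [formWord_concat] at hA
    rw [List.isChain_iff_forall_rel_of_append_cons_cons]
    rintro b b' B₁ B₂ rfl h
    exact hA.right_chain hB h

/-! ### Normal forms are canonical representatives -/

theorem isChain_desc (i j : ℕ) : (desc i j).IsChain fun x y ↦ x < y ∨ x = y + 1 := by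
  induction i with
  | zero =>
    rcases j with _ | j
    · simp [desc_self]
    · simp [desc_eq_nil]
  | succ i ih =>
    rcases Nat.lt_or_ge (i + 1) j with h | h
    · simp [desc_eq_nil h]
    · rw [desc_cons h, List.isChain_cons]
      refine ⟨fun y hy ↦ Or.inr ?_, ih⟩
      rcases Nat.lt_or_ge i j with h' | h'
      · simp [desc_eq_nil h'] at hy
      · obtain ⟨u, hu⟩ := desc_eq_cons h'
        rw [hu] at hy
        simp at hy
        omega

theorem isChain_asc (i j : ℕ) : (asc i j).IsChain fun x y ↦ x < y ∨ x = y + 1 :=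
  (List.Ico.pairwise_lt i (j + 1)).isChain.imp fun _ _ h ↦ Or.inl h

theorem isChain_hWord {n i r : ℕ} (hr : 2 ≤ r) :
    (hWord n i r).IsChain fun x y ↦ x < y ∨ x = y + 1 := by
  refine List.isChain_append.2 ⟨isChain_desc _ _, isChain_asc _ _, fun x hx y hy ↦ Or.inl ?_⟩
  have h2 := mem_asc.1 (List.mem_of_mem_head? hy)
  rcases Nat.lt_or_ge i 1 with h | h
  · simp [desc_eq_nil h] at hx
  · rw [desc_concat h] at hx
    simp at hx
    omega

theorem isChain_blockWord {n : ℕ} {B : List (ℕ × ℕ)} (hB : IsStembridge n B) :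
    (blockWord B).IsChain fun x y ↦ x < y ∨ x = y + 1 := by
  induction B with
  | nil => simp [blockWord]
  | cons b B ih =>
    rw [blockWord_cons]
    refine List.isChain_append.2 ⟨isChain_desc _ _, ih hB.of_cons, fun x hx y hy ↦ Or.inl ?_⟩
    have hb := hB.2 b (by simp)
    rw [desc_concat hb.2.1] at hx
    obtain ⟨c, hc, hc'⟩ := mem_blockWord.1 (List.mem_of_mem_head? hy)
    have := (List.pairwise_cons.1 hB.1).1 c hc
    simp at hx
    omega

/-- Converse of `isChain_of_lexMax`. A letter still available after appending `b` was at most the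
previous letter `c`; if `c = b + 1`, then `c` itself is blocked by `b`. -/
theorem LexMax.append {n : ℕ} {P S : List ℕ} (hP : LexMax n P) (h0 : ∀ a, Av n a P → a = 0)
    (hS : S.IsChain fun x y ↦ x < y ∨ x = y + 1) (hle : ∀ x ∈ S, x ≤ n) : LexMax n (P ++ S) := by
  induction S using List.reverseRecOn with
  | nil => simpa using hP
  | append_singleton S b ih =>
    have ih := ih hS.left_of_append fun x hx ↦ hle x (by simp [hx])
    rw [← List.append_assoc, lexMax_concat]
    refine ⟨ih, fun a ha ↦ ?_⟩
    rcases av_concat.1 ha with rfl | ⟨ha, hab, hadj⟩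
    · exact le_rfl
    rcases List.eq_nil_or_concat S with rfl | ⟨S, c, rfl⟩
    · rw [h0 a (by simpa using ha)]
      exact Nat.zero_le b
    · rw [List.concat_eq_append] at *
      rw [← List.append_assoc] at ih ha
      have h1 := (lexMax_concat.1 ih).2 a ha
      have hc := hle c (by simp)
      have hcb : c < b ∨ c = b + 1 :=
        List.isChain_iff_forall_rel_of_append_cons_cons.1 hS (l₁ := S) (l₂ := []) (by simp)
      unfold Adj at hadj
      omega

/-- Each appended letter blocks the one before it; besides `0`, only the latest letter of the
descent stays available. -/
theorem Av.of_append_desc {n a i : ℕ} {P : List ℕ} (hi : i ≤ n)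
    (h0 : ∀ a, Av n a P → a = 0 ∨ (a = i + 1 ∧ a ≤ n)) (h : Av n a (P ++ desc i 1)) :
    a = 0 ∨ (a = 1 ∧ a ≤ n) := by
  induction i generalizing P with
  | zero => simpa using h0 a (by simpa [desc_eq_nil] using h)
  | succ i ih =>
    rw [desc_cons (by omega), List.append_cons] at h
    refine ih (by omega) (fun c hc ↦ ?_) h
    rcases av_concat.1 hc with rfl | ⟨hc, -, hadj⟩
    · omega
    · have := h0 c hc
      unfold Adj at hadj
      omega

theorem Av.of_append_asc {n a r : ℕ} {P : List ℕ} (hr : r ≤ n + 1)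
    (h0 : ∀ a, Av n a P → a = 0 ∨ a = 1 ∨ a + 1 = r) (h : Av n a (P ++ asc r n)) :
    a = 0 ∨ a = 1 ∨ a = n := by
  induction hm : n + 1 - r generalizing P r with
  | zero =>
    have := h0 a (by simpa [asc_eq_nil (show n < r by omega)] using h)
    omega
  | succ m ih =>
    rw [asc_cons (by omega), List.append_cons] at h
    refine ih (by omega) (fun c hc ↦ ?_) h (by omega)
    rcases av_concat.1 hc with rfl | ⟨hc, -, hadj⟩
    · omega
    · have := h0 c hc
      unfold Adj at hadj
      omega

/-- Canonical words in which only the letter `0` can be commuted to the end. -/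
def ZeroLast (n : ℕ) (P : List ℕ) : Prop :=
  LexMax n P ∧ (∀ a, Av n a P → a = 0) ∧ ∀ x ∈ P, x ≤ n

/-- After h(i, r) only `0`, `1` and `n` can be available, and the appended `0` blocks its neighbours
`1` and `n`. -/
theorem ZeroLast.append {n i r : ℕ} {P : List ℕ} (hP : ZeroLast n P) (hi : i ≤ n)
    (hr2 : 2 ≤ r) (hr : r ≤ n + 1) : ZeroLast n (P ++ (hWord n i r ++ [0])) := by
  obtain ⟨h1, h2, h3⟩ := hP
  have hle : ∀ x ∈ hWord n i r, x ≤ n := by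
    intro x hx
    rw [mem_hWord] at hx
    omega
  have h4 := h1.append h2 (isChain_hWord (i := i) hr2) hle
  have h5 : ∀ a, Av n a (P ++ hWord n i r ++ [0]) → a = 0 := by
    intro a ha
    rcases av_concat.1 ha with rfl | ⟨ha, h0, hadj⟩
    · rfl
    · rw [hWord, ← List.append_assoc] at ha
      have := ha.of_append_asc hr fun c hc ↦ by
        have := hc.of_append_desc hi fun d hd ↦ Or.inl (h2 d hd)
        omega
      unfold Adj at hadj
      omega
  rw [← List.append_assoc]
  refine ⟨lexMax_concat.2 ⟨h4, fun a ha ↦ (h5 a ha).le⟩, h5, fun x hx ↦ ?_⟩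
  rcases List.mem_append.1 hx with hx | hx
  · rcases List.mem_append.1 hx with hx | hx
    · exact h3 x hx
    · exact hle x hx
  · rw [List.mem_singleton.1 hx]
    exact Nat.zero_le n

theorem IsNormalData.zeroLast {n : ℕ} {H : List (ℕ × ℕ)} {j k : ℕ} {B : List (ℕ × ℕ)}
    (hd : IsNormalData n H j k B) : ZeroLast n (formWord n H j k []) := by
  have hj := hd.j_mem
  have hgap := hd.gap
  -- Only the ranges of the parameters matter for being canonical, not the nesting; they pass to
  -- shorter `H` and smaller `k`.
  clear hd
  induction k with
  | zero =>
    induction H using List.reverseRecOn with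
    | nil => exact ⟨lexMax_nil n, fun a ha ↦ absurd ha not_av_nil, by simp [formWord, blockWord]⟩
    | append_singleton H q ih =>
      have hq := hgap q (by simp)
      rw [formWord_concat]
      exact (ih fun q hq ↦ hgap q (by simp [hq])).append (by omega) (by omega) hq.2
  | succ k ih =>
    have := hj (by omega)
    rw [formWord_succ]
    exact (ih fun _ ↦ this).append this.2 (by omega) (by omega)

theorem IsNormalData.lexMax {n : ℕ} {H : List (ℕ × ℕ)} {j k : ℕ} {B : List (ℕ × ℕ)}
    (hd : IsNormalData n H j k B) :
    LexMax n (formWord n H j k B) ∧ ∀ x ∈ formWord n H j k B, x ≤ n := by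
  obtain ⟨h1, h2, h3⟩ := hd.zeroLast
  have hle : ∀ x ∈ blockWord B, x ≤ n := by
    intro x hx
    obtain ⟨b, hb, hb'⟩ := mem_blockWord.1 hx
    have := hd.right.2 b hb
    omega
  rw [formWord_eq_append]
  refine ⟨h1.append h2 (isChain_blockWord hd.right) hle, fun x hx ↦ ?_⟩
  rcases List.mem_append.1 hx with hx | hx
  · exact h3 x hx
  · exact hle x hx

theorem map_val_map_ofNat {n : ℕ} {ω : List ℕ} (h : ∀ x ∈ ω, x ≤ n) :
    (ω.map (Fin.ofNat (n + 1))).map Fin.val = ω := by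
  rw [List.map_map]
  conv_rhs => rw [← List.map_id ω]
  refine List.map_congr_left fun x hx ↦ ?_
  simp only [Function.comp_apply, Fin.val_ofNat, id_eq]
  exact Nat.mod_eq_of_lt (Nat.lt_succ_of_le (h x hx))

theorem existsUnique_isNormalForm {n : ℕ} (hn : 1 ≤ n) {w : WAff n} (hw : w ∈ WcAff n) :
    ∃! ω : List (Fin (n + 1)), IsNormalForm n w ω := by
  have D := isCycleDiagram_affineA hn
  obtain ⟨η, hη, rfl⟩ := (csAff n).exists_isReduced w
  have hA := alt_of_mem_WcAff hn hη hw
  obtain ⟨v, hv, hM, hle⟩ := exists_lexMax_eqv hn _ (D.map_le η)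
  obtain ⟨H, j, k, B, hd, rfl⟩ := exists_isNormalData hn hle (hA.eqv hv) hM
  have hval := map_val_map_ofNat hle
  have hE : Eqv n (η.map Fin.val)
      (((formWord n H j k B).map (Fin.ofNat (n + 1))).map Fin.val) := by rwa [hval]
  have hp := D.wordProd_eq_of_eqv (csAff n) hn hE
  refine ⟨(formWord n H j k B).map (Fin.ofNat (n + 1)),
    ⟨isReduced_of_eq _ hη hp.symm (D.length_eq_of_eqv hn hE).ge, hp.symm, H, j, k, B, hd, rfl⟩, ?_⟩
  rintro _ ⟨hr, hp', H', j', k', B', hd', rfl⟩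
  have hE' := eqv_of_mem_WcAff hn hη hr hp'.symm hw
  rw [map_val_map_ofNat hd'.lexMax.2] at hE'
  rw [hd'.lexMax.1.eq_of_eqv hn hM hd'.lexMax.2 hle (hE'.symm.trans hv)]

/-! ### Substituting a word for the letter zero -/

/-- Replace every `0` by the word `l`. -/
def substWord (l : List ℕ) (ω : List ℕ) : List ℕ := ω.flatMap fun i ↦ if i = 0 then l else [i]

theorem substWord_cons (l : List ℕ) (a : ℕ) (ω : List ℕ) :
    substWord l (a :: ω) = (if a = 0 then l else [a]) ++ substWord l ω := by
  simp [substWord]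

theorem Adj.succ_cases {n s t : ℕ} (hn : 1 ≤ n) (h : Adj (n + 1) s t) :
    Adj n s t ∨ (s = n ∧ t = n + 1) ∨ (s = n + 1 ∧ t = n) ∨ (s = n + 1 ∧ t = 0) ∨
      (s = 0 ∧ t = n + 1) := by
  unfold Adj at *
  omega

theorem Adj.succ_or {n s t : ℕ} (h : Adj n s t) :
    Adj (n + 1) s t ∨ (s = n ∧ t = 0) ∨ (s = 0 ∧ t = n) := by
  unfold Adj at *
  omega

section Subst

variable {n : ℕ} {l : List ℕ}

/-- This includes the pair `n, 0`, which is no longer adjacent in the larger cycle. -/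
theorem proj_substWord (hl : l = [n + 1, 0] ∨ l = [0, n + 1]) {s t : ℕ} (hs : s ≤ n) (ht : t ≤ n)
    (ω : List ℕ) : proj s t (substWord l ω) = proj s t ω := by
  induction ω with
  | nil => rfl
  | cons a ω ih =>
    have hn1 : ¬(n + 1 = s ∨ n + 1 = t) := by omega
    have hl' : proj s t l = proj s t [0] := by
      rcases hl with rfl | rfl
      · rw [proj_cons_of_notMem hn1]
      · rw [show [0, n + 1] = [0] ++ [n + 1] from rfl, proj_append, proj_cons_of_notMem hn1]
        simp
    rw [substWord_cons, show a :: ω = [a] ++ ω from rfl, proj_append, proj_append, ih]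
    split_ifs with ha
    · rw [ha, hl']
    · rfl

/-- The new letter takes over the role of `0` as a neighbour of `n`; the swap renames it. -/
theorem proj_substWord_last (hn : 1 ≤ n) (hl : l = [n + 1, 0] ∨ l = [0, n + 1]) (ω : List ℕ)
    (hω : ∀ x ∈ ω, x ≤ n) :
    proj n (n + 1) (substWord l ω) = (proj n 0 ω).map (Equiv.swap 0 (n + 1)) := by
  induction ω with
  | nil => rfl
  | cons a ω ih =>
    have ha := hω a (by simp)
    have h0 : ¬(0 = n ∨ 0 = n + 1) := by omega
    have hl' : proj n (n + 1) l = [n + 1] := by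
      rcases hl with rfl | rfl
      · rw [proj_cons_of_mem (Or.inr rfl), proj_cons_of_notMem h0, proj_nil]
      · rw [proj_cons_of_notMem h0, proj_cons_of_mem (Or.inr rfl), proj_nil]
    rw [substWord_cons, show a :: ω = [a] ++ ω from rfl, proj_append, proj_append,
      ih fun x hx ↦ hω x (by simp [hx]), List.map_append]
    congr 1
    split_ifs with h
    · rw [h, hl', proj_cons_of_mem (Or.inr rfl)]
      simp
    · by_cases h' : a = n
      · rw [proj_cons_of_mem (Or.inl h'), proj_cons_of_mem (Or.inl h')]
        simp [Equiv.swap_apply_of_ne_of_ne h (show a ≠ n + 1 by omega)]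
      · rw [proj_cons_of_notMem (by omega), proj_cons_of_notMem (by omega)]
        simp

theorem proj_substWord_zero (hl : l = [n + 1, 0] ∨ l = [0, n + 1]) (ω : List ℕ)
    (hω : ∀ x ∈ ω, x ≤ n) :
    proj (n + 1) 0 (substWord l ω) = (proj 0 0 ω).flatMap fun _ ↦ l := by
  induction ω with
  | nil => rfl
  | cons a ω ih =>
    have ha := hω a (by simp)
    have hl' : proj (n + 1) 0 l = l := by
      rcases hl with rfl | rfl <;> simp [proj]
    rw [substWord_cons, proj_append, ih fun x hx ↦ hω x (by simp [hx])]
    split_ifs with h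
    · rw [hl', proj_cons_of_mem (Or.inl h), List.flatMap_cons]
    · rw [proj_cons_of_notMem (by omega), proj_cons_of_notMem (by omega)]
      rfl

theorem Eqv.proj_zero_zero {u v : List ℕ} (hn : 1 ≤ n) (h : Eqv n u v) :
    proj 0 0 u = proj 0 0 v := by
  have key : ∀ w, proj 0 0 w = (proj 0 1 w).filter (· = 0) := by
    intro w
    rw [proj, proj, List.filter_filter]
    congr 1
    ext x
    by_cases hx : x = 0 <;> simp [hx]
  rw [key, key, h 0 1 (by unfold Adj; omega)]

theorem Eqv.substWord (hn : 1 ≤ n) (hl : l = [n + 1, 0] ∨ l = [0, n + 1]) {u v : List ℕ}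
    (hu : ∀ x ∈ u, x ≤ n) (hv : ∀ x ∈ v, x ≤ n) (h : Eqv n u v) :
    Eqv (n + 1) (substWord l u) (substWord l v) := by
  have h1 : proj n (n + 1) (AffineFC.substWord l u) = proj n (n + 1) (AffineFC.substWord l v) := by
    rw [proj_substWord_last hn hl u hu, proj_substWord_last hn hl v hv,
      h n 0 (by unfold Adj; omega)]
  have h2 : proj (n + 1) 0 (AffineFC.substWord l u) = proj (n + 1) 0 (AffineFC.substWord l v) := by
    rw [proj_substWord_zero hl u hu, proj_substWord_zero hl v hv, h.proj_zero_zero hn]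
  intro s t hst
  rcases hst.succ_cases hn with h' | ⟨rfl, rfl⟩ | ⟨rfl, rfl⟩ | ⟨rfl, rfl⟩ | ⟨rfl, rfl⟩
  · rw [proj_substWord hl h'.1 h'.2.1, proj_substWord hl h'.1 h'.2.1, h s t h']
  · exact h1
  · rw [proj_comm, h1, proj_comm]
  · exact h2
  · rw [proj_comm, h2, proj_comm]

/-- The only old edge lost is the one between `n` and `0`, and its projection is recovered from the
pair `n, n + 1`. -/
theorem Eqv.of_substWord (hn : 1 ≤ n) (hl : l = [n + 1, 0] ∨ l = [0, n + 1]) {u v : List ℕ}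
    (hu : ∀ x ∈ u, x ≤ n) (hv : ∀ x ∈ v, x ≤ n)
    (h : Eqv (n + 1) (AffineFC.substWord l u) (AffineFC.substWord l v)) : Eqv n u v := by
  have h1 : proj n 0 u = proj n 0 v := by
    apply (List.map_injective_iff.2 (Equiv.swap 0 (n + 1)).injective)
    rw [← proj_substWord_last hn hl u hu, ← proj_substWord_last hn hl v hv,
      h n (n + 1) (by unfold Adj; omega)]
  intro s t hst
  rcases hst.succ_or with h' | ⟨rfl, rfl⟩ | ⟨rfl, rfl⟩
  · rw [← proj_substWord hl hst.1 hst.2.1, ← proj_substWord hl hst.1 hst.2.1 v, h s t h']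
  · exact h1
  · rw [proj_comm, h1, proj_comm]

theorem isChain_flatMap_pair {c d : ℕ} (hcd : c ≠ d) (L : List ℕ) :
    (L.flatMap fun _ ↦ [c, d]).IsChain (· ≠ ·) := by
  induction L with
  | nil => simp
  | cons a L ih =>
    rcases L with _ | ⟨b, L⟩
    · simpa using hcd
    · simp only [List.flatMap_cons, List.cons_append, List.nil_append, List.isChain_cons_cons]
        at ih ⊢
      exact ⟨hcd, hcd.symm, ih⟩

theorem Alt.substWord (hn : 1 ≤ n) (hl : l = [n + 1, 0] ∨ l = [0, n + 1]) {u : List ℕ}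
    (hu : ∀ x ∈ u, x ≤ n) (h : Alt n u) : Alt (n + 1) (substWord l u) := by
  rw [alt_iff_isChain_proj] at *
  have h1 : (proj n (n + 1) (AffineFC.substWord l u)).IsChain (· ≠ ·) := by
    rw [proj_substWord_last hn hl u hu, List.isChain_map]
    exact (h n 0 (by unfold Adj; omega)).imp fun a b hab ↦ (Equiv.swap 0 (n + 1)).injective.ne hab
  have h2 : (proj (n + 1) 0 (AffineFC.substWord l u)).IsChain (· ≠ ·) := by
    rw [proj_substWord_zero hl u hu]
    rcases hl with rfl | rfl
    · exact isChain_flatMap_pair (by omega) _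
    · exact isChain_flatMap_pair (by omega) _
  intro s t hst
  rcases hst.succ_cases hn with h' | ⟨rfl, rfl⟩ | ⟨rfl, rfl⟩ | ⟨rfl, rfl⟩ | ⟨rfl, rfl⟩
  · rw [proj_substWord hl h'.1 h'.2.1]
    exact h s t h'
  · exact h1
  · rwa [proj_comm]
  · exact h2
  · rwa [proj_comm]

theorem count_zero_substWord (hl : l = [n + 1, 0] ∨ l = [0, n + 1]) (ω : List ℕ) :
    (substWord l ω).count 0 = ω.count 0 := by
  induction ω with
  | nil => rfl
  | cons a ω ih =>
    rw [substWord_cons, List.count_append, ih, List.count_cons]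
    split_ifs with h1 h2 h2
    · rcases hl with rfl | rfl <;> simp [add_comm]
    · simp [h1] at h2
    · simp [h1] at h2
    · simp [h1]

theorem length_substWord (hl : l = [n + 1, 0] ∨ l = [0, n + 1]) (ω : List ℕ) :
    (substWord l ω).length = ω.length + ω.count 0 := by
  induction ω with
  | nil => rfl
  | cons a ω ih =>
    rw [substWord_cons, List.length_append, ih, List.count_cons, List.length_cons]
    split_ifs with h1 h2 h2
    · rcases hl with rfl | rfl <;> simp <;> omega
    · simp [h1] at h2
    · simp [h1] at h2
    · simp
      omega

theorem substWord_eq_self (l : List ℕ) {ω : List ℕ} (h : 0 ∉ ω) : substWord l ω = ω := by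
  induction ω with
  | nil => rfl
  | cons a ω ih =>
    simp only [List.mem_cons, not_or] at h
    rw [substWord_cons, ih h.2, if_neg (Ne.symm h.1)]
    rfl

/-- If the words obtained by two opposite substitutions have the same projections, then the letter
zero does not occur. -/
theorem notMem_zero_of_eqv {u v : List ℕ} (hu : ∀ x ∈ u, x ≤ n) (hv : ∀ x ∈ v, x ≤ n)
    (h : Eqv (n + 1) (substWord [n + 1, 0] u) (substWord [0, n + 1] v)) : 0 ∉ u := by
  intro h0
  have h1 := h (n + 1) 0 (by unfold Adj; omega)
  rw [proj_substWord_zero (Or.inl rfl) u hu, proj_substWord_zero (Or.inr rfl) v hv] at h1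
  have h2 : 0 ∈ proj 0 0 u := mem_proj.2 ⟨h0, Or.inl rfl⟩
  rcases hpu : proj 0 0 u with _ | ⟨a, p⟩
  · simp [hpu] at h2
  · rcases hpv : proj 0 0 v with _ | ⟨b, q⟩ <;> simp [hpu, hpv] at h1

end Subst

theorem map_val_substI {n : ℕ} (ω : List (Fin (n + 1))) :
    (substI n ω).map Fin.val = substWord [n + 1, 0] (ω.map Fin.val) := by
  induction ω with
  | nil => rfl
  | cons i ω ih =>
    rw [List.map_cons, substWord_cons, ← ih, substI, List.flatMap_cons, List.map_append]
    congr 1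
    by_cases h : i = 0
    · rw [if_pos h, if_pos (by rw [h]; rfl)]
      rfl
    · rw [if_neg h, if_neg fun h' : (i : ℕ) = 0 ↦ h (Fin.ext h')]
      rfl

theorem map_val_substJ {n : ℕ} (ω : List (Fin (n + 1))) :
    (substJ n ω).map Fin.val = substWord [0, n + 1] (ω.map Fin.val) := by
  induction ω with
  | nil => rfl
  | cons i ω ih =>
    rw [List.map_cons, substWord_cons, ← ih, substJ, List.flatMap_cons, List.map_append]
    congr 1
    by_cases h : i = 0
    · rw [if_pos h, if_pos (by rw [h]; rfl)]
      rfl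
    · rw [if_neg h, if_neg fun h' : (i : ℕ) = 0 ↦ h (Fin.ext h')]
      rfl

/-! ### The parabolic subgroup of type `A_n` -/

/-- The word in the generators of `W(Ã_m)` which corresponds to a word in those of `W(A_n)`. -/
def embWord (n m : ℕ) (h : n ≤ m) (η : List (Fin n)) : List (Fin (m + 1)) :=
  η.map fun i : Fin n ↦ ⟨i + 1, by have := i.2; omega⟩

theorem map_val_embWord {n m : ℕ} (h : n ≤ m) (η : List (Fin n)) :
    (embWord n m h η).map Fin.val = η.map fun i : Fin n ↦ (i : ℕ) + 1 := by
  simp [embWord]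

theorem embA_wordProd {n m : ℕ} (h : n ≤ m) (η : List (Fin n)) :
    embA n m h ((CoxeterMatrix.A n).toCoxeterSystem.wordProd η) =
      (csAff m).wordProd (embWord n m h η) := by
  induction η with
  | nil => simp [embWord]
  | cons i η ih =>
    rw [CoxeterSystem.wordProd_cons, map_mul, ih, embWord, embWord, List.map_cons,
      CoxeterSystem.wordProd_cons]
    congr 1

theorem exists_embWord_eq {n : ℕ} {ω : List (Fin (n + 1))} (h : 0 ∉ ω) :
    ∃ η, embWord n n le_rfl η = ω := by
  induction ω with
  | nil => exact ⟨[], rfl⟩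
  | cons i ω ih =>
    simp only [List.mem_cons, not_or] at h
    obtain ⟨η, rfl⟩ := ih h.2
    have hi : (i : ℕ) ≠ 0 := fun h' ↦ h.1 (Fin.ext h'.symm)
    refine ⟨⟨i - 1, by omega⟩ :: η, ?_⟩
    rw [embWord, List.map_cons, embWord]
    congr 1
    exact Fin.ext (by simp; omega)

theorem alt_of_mem_WcA {n : ℕ} (hn : 1 ≤ n) {η : List (Fin n)}
    (hη : (CoxeterMatrix.A n).toCoxeterSystem.IsReduced η)
    (hu : (CoxeterMatrix.A n).toCoxeterSystem.wordProd η ∈ WcA n) :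
    Alt n ((embWord n n le_rfl η).map Fin.val) := by
  rw [map_val_embWord]
  exact (isCycleDiagram_A n).alt_of_fullyCommutative _ hn hη hu

/-- The question is transferred to the affine group: a reduced `ζ` for the same element is no longer
than `η`, so its image is reduced there, where uniqueness up to commutations is known. -/
theorem mem_WcA_of_alt {n : ℕ} (hn : 1 ≤ n) {η : List (Fin n)}
    (hη : Alt n ((embWord n n le_rfl η).map Fin.val)) :
    (CoxeterMatrix.A n).toCoxeterSystem.wordProd η ∈ WcA n := by
  have hlen : ∀ ζ : List (Fin n), (embWord n n le_rfl ζ).length = ζ.length := fun ζ ↦ by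
    simp [embWord]
  have key : ∀ ζ, (CoxeterMatrix.A n).toCoxeterSystem.IsReduced ζ →
      (CoxeterMatrix.A n).toCoxeterSystem.wordProd ζ =
        (CoxeterMatrix.A n).toCoxeterSystem.wordProd η →
      Eqv n (ζ.map fun i : Fin n ↦ (i : ℕ) + 1) (η.map fun i : Fin n ↦ (i : ℕ) + 1) := by
    intro ζ hζ hp
    have hp' : (csAff n).wordProd (embWord n n le_rfl ζ) =
        (csAff n).wordProd (embWord n n le_rfl η) := by
      rw [← embA_wordProd, ← embA_wordProd, hp]
    have h1 := (CoxeterMatrix.A n).toCoxeterSystem.length_wordProd_le η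
    rw [← hp, hζ.eq] at h1
    have hr := isReduced_of_eq _ (hη.isReduced hn) hp' (by rwa [hlen, hlen])
    have := (hη.isReduced_and_eqv hn).2 _ hr hp'
    rwa [map_val_embWord, map_val_embWord] at this
  intro ζ ζ' h1 h2 h3 h4
  exact (isCycleDiagram_A n).reflTransGen_of_eqv hn ((key ζ h1 h2).trans (key ζ' h3 h4).symm)

/-! ### The two injections -/

/-- A substitution on words which replaces `0` by `l` descends to fully commutative elements. -/
theorem exists_substitution {n : ℕ} (hn : 1 ≤ n) {l : List ℕ}
    (hl : l = [n + 1, 0] ∨ l = [0, n + 1]) {F : List (Fin (n + 1)) → List (Fin (n + 2))}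
    (hF : ∀ ω, (F ω).map Fin.val = substWord l (ω.map Fin.val)) :
    ∃ I : WcAff n → WcAff (n + 1),
      (∀ (w : WcAff n) (ω : List (Fin (n + 1))), (csAff n).IsReduced ω → (csAff n).wordProd ω = w →
        (csAff (n + 1)).IsReduced (F ω) ∧
          (I w : WAff (n + 1)) = (csAff (n + 1)).wordProd (F ω)) ∧
      (∀ w : WcAff n, affineLength (n + 1) (I w) = affineLength n w ∧
        (csAff (n + 1)).length (I w) = (csAff n).length w + affineLength n w) ∧
      Function.Injective I ∧
      ∀ u ∈ WcA n, ∀ w : WcAff n, (w : WAff n) = embA n n le_rfl u →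
        (I w : WAff (n + 1)) = embA n (n + 1) n.le_succ u := by
  have D := isCycleDiagram_affineA hn
  have D' := isCycleDiagram_affineA (n := n + 1) (by omega)
  have hFA : ∀ ω, Alt n (ω.map Fin.val) → Alt (n + 1) ((F ω).map Fin.val) := by
    intro ω hω
    rw [hF]
    exact hω.substWord hn hl (D.map_le ω)
  choose ρ hρ hρ' using fun w : WAff n ↦ (csAff n).exists_isReduced w
  have hρA : ∀ w : WcAff n, Alt n ((ρ w).map Fin.val) := fun w ↦
    alt_of_mem_WcAff hn (hρ w) (by rw [← hρ' w]; exact w.2)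
  -- Any reduced expression may be chosen: two of them are equivalent, and the substitution
  -- preserves equivalence. The formula for normal forms is then a special case of `hI`.
  let I : WcAff n → WcAff (n + 1) := fun w ↦
    ⟨(csAff (n + 1)).wordProd (F (ρ w)), (hFA _ (hρA w)).mem_WcAff (by omega)⟩
  have hI : ∀ (w : WcAff n) (ω : List (Fin (n + 1))), (csAff n).IsReduced ω →
      (csAff n).wordProd ω = w → (csAff (n + 1)).IsReduced (F ω) ∧
        (I w : WAff (n + 1)) = (csAff (n + 1)).wordProd (F ω) := by
    intro w ω hω hw
    have hA := alt_of_mem_WcAff hn hω (by rw [hw]; exact w.2)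
    refine ⟨(hFA ω hA).isReduced (by omega), ?_⟩
    have hE := eqv_of_mem_WcAff hn (hρ w) hω (by rw [hw, ← hρ' w]) (by rw [← hρ' w]; exact w.2)
    refine D'.wordProd_eq_of_eqv (csAff (n + 1)) (by omega) ?_
    rw [hF, hF]
    exact hE.substWord hn hl (D.map_le _) (D.map_le _)
  refine ⟨I, hI, fun w ↦ ?_, fun w w' h ↦ ?_, fun u hu w hw ↦ ?_⟩
  · obtain ⟨h1, h2⟩ := hI w (ρ w) (hρ w) (hρ' w).symm
    have hc : ∀ (m : ℕ) (ω : List (Fin (m + 1))), ω.count 0 = (ω.map Fin.val).count 0 :=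
      fun m ω ↦ (List.count_map_of_injective ω Fin.val Fin.val_injective 0).symm
    have h3 : affineLength n w = ((ρ w).map Fin.val).count 0 := by
      rw [affineLength_wordProd w.2 (hρ w) (hρ' w).symm, hc]
    constructor
    · rw [affineLength_wordProd (I w).2 h1 h2.symm, h3, hc, hF, count_zero_substWord hl]
    · have h4 : (csAff n).length w = (ρ w).length := by
        conv_lhs => rw [hρ' w]
        exact hρ w
      rw [h2, h1.eq, h3, h4, ← List.length_map (f := Fin.val), hF, length_substWord hl,
        List.length_map]
  · have h1 := hI w (ρ w) (hρ w) (hρ' w).symm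
    have h2 := hI w' (ρ w') (hρ w') (hρ' w').symm
    have h3 := eqv_of_mem_WcAff (by omega) h1.1 h2.1 (by rw [← h1.2, ← h2.2, h])
      (by rw [← h1.2]; exact (I w).2)
    rw [hF, hF] at h3
    have h4 := D.wordProd_eq_of_eqv (csAff n) hn
      (h3.of_substWord hn hl (D.map_le _) (D.map_le _))
    exact Subtype.ext (by rw [hρ' w, hρ' w', h4])
  · obtain ⟨η, hη, rfl⟩ := (CoxeterMatrix.A n).toCoxeterSystem.exists_isReduced u
    have hA := alt_of_mem_WcA hn hη hu
    have h1 := hI w _ (hA.isReduced hn) (by rw [hw, embA_wordProd])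
    rw [h1.2, embA_wordProd]
    congr 1
    apply List.map_injective_iff.2 Fin.val_injective
    rw [hF, map_val_embWord, map_val_embWord, substWord_eq_self]
    simp

end AffineFC

/-! ### The main theorem -/

open AffineFC in
theorem mainTheorem3 (n : ℕ) (hn : 1 ≤ n) :
    (∀ w ∈ WcAff n, ∃! ω : List (Fin (n + 1)), IsNormalForm n w ω) ∧
    ∃ I J : WcAff n → WcAff (n + 1),
      (∀ (w : WcAff n) (ω : List (Fin (n + 1))), IsNormalForm n w ω →
        ((csAff (n + 1)).IsReduced (substI n ω) ∧
          (I w : WAff (n + 1)) = (csAff (n + 1)).wordProd (substI n ω)) ∧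
        ((csAff (n + 1)).IsReduced (substJ n ω) ∧
          (J w : WAff (n + 1)) = (csAff (n + 1)).wordProd (substJ n ω))) ∧
      (∀ w : WcAff n,
        affineLength (n + 1) (I w) = affineLength n w ∧
        affineLength (n + 1) (J w) = affineLength n w ∧
        (csAff (n + 1)).length (I w) = (csAff n).length w + affineLength n w ∧
        (csAff (n + 1)).length (J w) = (csAff n).length w + affineLength n w) ∧
      Function.Injective I ∧ Function.Injective J ∧
      (∀ u ∈ WcA n, ∀ w : WcAff n, (w : WAff n) = embA n n le_rfl u →
        (I w : WAff (n + 1)) = embA n (n + 1) n.le_succ u ∧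
        (J w : WAff (n + 1)) = embA n (n + 1) n.le_succ u) ∧
      Subtype.val '' (Set.range I ∩ Set.range J) = embA n (n + 1) n.le_succ '' WcA n := by
  obtain ⟨I, hI, hIl, hIi, hIA⟩ := exists_substitution hn (Or.inl rfl) (map_val_substI (n := n))
  obtain ⟨J, hJ, hJl, hJi, hJA⟩ := exists_substitution hn (Or.inr rfl) (map_val_substJ (n := n))
  have D := isCycleDiagram_affineA hn
  refine ⟨fun w hw ↦ existsUnique_isNormalForm hn hw, I, J,
    fun w ω h ↦ ⟨hI w ω h.1 h.2.1, hJ w ω h.1 h.2.1⟩,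
    fun w ↦ ⟨(hIl w).1, (hJl w).1, (hIl w).2, (hJl w).2⟩, hIi, hJi,
    fun u hu w hw ↦ ⟨hIA u hu w hw, hJA u hu w hw⟩, ?_⟩
  ext x
  constructor
  · rintro ⟨_, ⟨⟨w, rfl⟩, ⟨w', hw'⟩⟩, rfl⟩
    obtain ⟨ω, hω, hωw⟩ := (csAff n).exists_isReduced (w : WAff n)
    obtain ⟨ω', hω', hωw'⟩ := (csAff n).exists_isReduced (w' : WAff n)
    obtain ⟨h1, h2⟩ := hI w ω hω hωw.symm
    obtain ⟨h3, h4⟩ := hJ w' ω' hω' hωw'.symm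
    have hE := eqv_of_mem_WcAff (by omega) h1 h3 (by rw [← h2, ← h4, hw'])
      (by rw [← h2]; exact (I w).2)
    rw [map_val_substI, map_val_substJ] at hE
    have h0 := notMem_zero_of_eqv (D.map_le _) (D.map_le _) hE
    obtain ⟨η, rfl⟩ := exists_embWord_eq (ω := ω) fun h ↦ h0 (List.mem_map.2 ⟨0, h, rfl⟩)
    have hu := mem_WcA_of_alt hn (alt_of_mem_WcAff hn hω (by rw [← hωw]; exact w.2))
    exact ⟨_, hu, (hIA _ hu w (by rw [hωw, embA_wordProd])).symm⟩
  · rintro ⟨u, hu, rfl⟩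
    obtain ⟨η, hη, rfl⟩ := (CoxeterMatrix.A n).toCoxeterSystem.exists_isReduced u
    have hw := (alt_of_mem_WcA hn hη hu).mem_WcAff hn
    have h1 := hIA _ hu ⟨_, hw⟩ (embA_wordProd _ _).symm
    have h2 := hJA _ hu ⟨_, hw⟩ (embA_wordProd _ _).symm
    exact ⟨_, ⟨⟨_, rfl⟩, ⟨⟨_, hw⟩, Subtype.ext (h2.trans h1.symm)⟩⟩, h1⟩
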